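/- **Setting.** For $n,m\ge 1$ and reals $m_x,m_y>0$, $L_x,L_{xy},L_y$, let $\mathcal F(m_x,m_y,L_x,L_{xy},L_y)$ be the class of differentiable $f:\mathbb R^n\times\mathbb R^m\to\mathbb R$ such that every $f(\cdot,y)$ is $m_x$-strongly convex, every $f(x,\cdot)$ is $m_y$-strongly concave, $\nabla_x f(\cdot,y)$ is $L_x$-Lipschitz, $\nabla_y f(x,\cdot)$ is $L_y$-Lipschitz, and $\nabla_x f(x,\cdot)$ and $\nabla_y f(\cdot,y)$ are $L_{xy}$-Lipschitz. Put $L=\max\{L_x,L_{xy},L_y\}$. Norms are Euclidean, $\|[x;y]\|^2=\|x\|^2+\|y\|^2$. A saddle point is a $z^*=[x^*;y^*]$ with $f(x^*,y)\le f(x^*,y^*)\le f(x,y^*)$ for all $x,y$. **The algorithms** (they access $f$ only through evaluations of $\nabla f$, which are counted). *AGD* with constants $l,\mu$, started at $x_0$, for $N$ steps on $h$: $\tilde x_0=x_0$, $\kappa=l/\mu$, and $x_t=\tilde x_{t-1}-\frac1l\nabla h(\tilde x_{t-1})$, $\tilde x_t=x_t+\frac{\sqrt\kappa-1}{\sqrt\kappa+1}(x_t-x_{t-1})$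 for $t=1,\dots,N$; it returns $x_N$. *ABR*$(h,[x_0;y_0],\epsilon,\mu_x,\mu_y,\ell_x,\ell_y)$: with $\kappa_x=\ell_x/\mu_x$, $\kappa_y=\ell_y/\mu_y$, perform $\lceil\log_2(4\sqrt{\kappa_x+\kappa_y}/\epsilon)\rceil$ rounds; in a round, $x_{t+1}$ is obtained by AGD on $h(\cdot,y_t)$ from $x_t$ with constants $\ell_x,\mu_x$ for $\lceil 2\sqrt{\kappa_x}\ln(24\kappa_x)\rceil$ steps, and then $y_{t+1}$ by AGD on $-h(x_{t+1},\cdot)$ from $y_t$ with constants $\ell_y,\mu_y$ for $\lceil 2\sqrt{\kappa_y}\ln(24\kappa_y)\rceil$ steps; it returns the last $[x_t;y_t]$. Let $\beta_1=\max\{m_x,L_{xy}\}$, $\beta_2=\max\{m_y,L_{xy}\}$, $M_1=80L^3/(m_x^{1.5}m_y^{1.5})$, $M_2=96L^{2.5}/(m_xm_y^{1.5})$, $\theta(\kappa)=\frac{2\sqrt\kappa-1}{2\sqrt\kappa+1}$, $\tau(\kappa)=\frac1{2\sqrt\kappa+4\kappa}$. *APPA-ABR*$(g,[x_0;y_0],M_1)$: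 with $\hat y_0=y_0$ and $\kappa=\beta_2/m_y$, repeat for $t=1,2,\dots$: $[x_t;y_t]=\mathrm{ABR}(g(x,y)-\beta_2\|y-\hat y_{t-1}\|^2,[x_{t-1};y_{t-1}],1/M_2,2\beta_1,2\beta_2,3L,3L)$ and $\hat y_t=y_t+\theta(\kappa)(y_t-y_{t-1})+\tau(\kappa)(y_t-\hat y_{t-1})$, until $\|\nabla g(x_t,y_t)\|\le\frac{\min\{m_x,m_y\}}{9LM_1}\|\nabla g(x_0,y_0)\|$; it returns $[x_t;y_t]$. *Proximal Best Response* (for $L_x=L_y$), started at $z_0=[x_0;y_0]$: with $\hat x_0=x_0$ and $\kappa=\beta_1/m_x$, for $t=1,\dots,T$: $[x_t;y_t]=\mathrm{APPA\text{-}ABR}(f(x,y)+\beta_1\|x-\hat x_{t-1}\|^2,[x_{t-1};y_{t-1}],M_1)$ and $\hat x_t=x_t+\theta(\kappa)(x_t-x_{t-1})+\tau(\kappa)(x_t-\hat x_{t-1})$; it produces $z_T=[x_T;y_T]$. If $L_x\ne L_y$, it is applied to $g(x,y)=f\big((L_y/L_x)^{1/4}x,(L_x/L_y)^{1/4}y\big)$,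 with the constants $\big(m_x\sqrt{L_y/L_x},\,m_y\sqrt{L_x/L_y},\,\sqrt{L_xL_y},\,L_{xy},\,\sqrt{L_xL_y}\big)$ of $g$ in the place of $(m_x,m_y,L_x,L_{xy},L_y)$ and the correspondingly rescaled starting point, and $z_T$ is the result scaled back. **Theorem 3.** There is an absolute constant $C>0$ such that the following holds for all $n,m\ge1$, all $m_x,m_y>0$ and $L_x,L_{xy},L_y$, and all $f\in\mathcal F(m_x,m_y,L_x,L_{xy},L_y)$. The function $f$ has exactly one saddle point $z^*$, and for every $z_0$ and every $\epsilon>0$ there is a number $T$ of iterations after which Proximal Best Response, started at $z_0$, has produced (every inner loop having terminated) a point $z_T$ with $\|z_T-z^*\|\le\epsilon$, using in total at most $$C\,\sqrt{\frac{L_x}{m_x}+\frac{L\cdot L_{xy}}{m_xm_y}+\frac{L_y}{m_y}}\;\cdot\;\max\Big\{1,\ln\frac{L^2}{m_xm_y}\Big\}^{3}\cdot\;\max\Big\{1,\ln\Big(\frac{L^2}{m_xm_y}\cdot\frac{\|z_0-z^*\|}{\epsilon}\Big)\Big\}$$ gradient evaluations (with $\ln$ of $0$ read as $0$, for $z_0=z^*$).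 -/

import Mathlib

namespace Minimax

/-- `ℝⁿ` with its Euclidean norm. -/
abbrev Vec (n : ℕ) : Type := EuclideanSpace ℝ (Fin n)

/-- Points `z = [x; y]` of `ℝⁿ × ℝᵐ`.  Distances between such points are always measured by
`enorm2` below, never by the sup norm of the product type. -/
abbrev Pt (n m : ℕ) : Type := Vec n × Vec m

/-- The Euclidean norm `‖[x; y]‖ = √(‖x‖² + ‖y‖²)` of `ℝⁿ⁺ᵐ`. -/
noncomputable def enorm2 {n m : ℕ} (z : Pt n m) : ℝ := ‖WithLp.toLp 2 z‖

/-! ### The function class -/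

/-- The partial gradient `∇ₓ f (x, y)`. -/
noncomputable def gradX {n m : ℕ} (f : Vec n → Vec m → ℝ) (x : Vec n) (y : Vec m) : Vec n :=
  gradient (fun x' => f x' y) x

/-- The partial gradient `∇_y f (x, y)`. -/
noncomputable def gradY {n m : ℕ} (f : Vec n → Vec m → ℝ) (x : Vec n) (y : Vec m) : Vec m :=
  gradient (fun y' => f x y') y

/-- `μ`-strong convexity of a differentiable function on `ℝᵈ`. -/
def StronglyConvex {d : ℕ} (μ : ℝ) (φ : Vec d → ℝ) : Prop :=
  ∀ u v : Vec d, φ u + inner ℝ (v - u) (gradient φ u) + μ / 2 * ‖v - u‖ ^ 2 ≤ φ v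

/-- The moduli of strong convexity and concavity and the smoothness constants. -/
structure Params where
  /-- strong convexity modulus in `x` -/
  mx : ℝ
  /-- strong concavity modulus in `y` -/
  my : ℝ
  /-- Lipschitz constant of `∇ₓ f` in `x` -/
  Lx : ℝ
  /-- Lipschitz constant of `∇ₓ f` in `y` and of `∇_y f` in `x` -/
  Lxy : ℝ
  /-- Lipschitz constant of `∇_y f` in `y` -/
  Ly : ℝ

/-- `L = max {Lₓ, Lₓᵧ, L_y}`. -/
noncomputable def Params.L (p : Params) : ℝ := max p.Lx (max p.Lxy p.Ly)

/-- The function class `𝓕(mₓ, m_y, Lₓ, Lₓᵧ, L_y)`. -/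
structure MemF {n m : ℕ} (p : Params) (f : Vec n → Vec m → ℝ) : Prop where
  differentiable : Differentiable ℝ (fun z : Pt n m => f z.1 z.2)
  stronglyConvex : ∀ y, StronglyConvex p.mx (fun x => f x y)
  stronglyConcave : ∀ x, StronglyConvex p.my (fun y => - f x y)
  lip_x_x : ∀ y x x', ‖gradX f x y - gradX f x' y‖ ≤ p.Lx * ‖x - x'‖
  lip_y_y : ∀ x y y', ‖gradY f x y - gradY f x y'‖ ≤ p.Ly * ‖y - y'‖
  lip_x_y : ∀ x y y', ‖gradX f x y - gradX f x y'‖ ≤ p.Lxy * ‖y - y'‖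
  lip_y_x : ∀ y x x', ‖gradY f x y - gradY f x' y‖ ≤ p.Lxy * ‖x - x'‖

/-- `z = (x*, y*)` is a saddle point of `f`. -/
def IsSaddlePoint {n m : ℕ} (f : Vec n → Vec m → ℝ) (z : Pt n m) : Prop :=
  ∀ x y, f z.1 z.2 ≤ f x z.2 ∧ f z.1 y ≤ f z.1 z.2

/-! ### Computations that count gradient evaluations -/

/-- A result together with the number of gradient evaluations spent on it. -/
structure Counted (α : Type) where
  /-- the result -/
  val : α
  /-- the number of gradient evaluations -/
  calls : ℕ

instance : Monad Counted where
  pure a := ⟨a, 0⟩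
  bind c k := ⟨(k c.val).val, c.calls + (k c.val).calls⟩

/-- A first-order oracle, returning `(∇ₓ g (z), ∇_y g (z))`. -/
abbrev Oracle (n m : ℕ) : Type := Pt n m → Counted (Pt n m)

/-- The gradient oracle of `f`: each query is one gradient evaluation.  The algorithms access `f`
only through this oracle. -/
noncomputable def gradOracle {n m : ℕ} (f : Vec n → Vec m → ℝ) : Oracle n m :=
  fun z => ⟨(gradX f z.1 z.2, gradY f z.1 z.2), 1⟩

/-- `for t = 1, …, T do s ← body s`. -/
def forLoop {σ : Type} (body : σ → Counted σ) : ℕ → σ → Counted σ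
  | 0, s => pure s
  | T + 1, s => do
      let s' ← body s
      forLoop body T s'

/-- `RepeatUntil body done s r`: the loop `repeat s ← body s until done s`, entered in the state
`s`, terminates with the result `r`. -/
inductive RepeatUntil {σ : Type} (body : σ → Counted σ) (done : σ → Counted Prop) :
    σ → Counted σ → Prop
  | last (s : σ) : (done (body s).val).val →
      RepeatUntil body done s
        ⟨(body s).val, (body s).calls + (done (body s).val).calls⟩
  | again (s : σ) (r : Counted σ) : ¬ (done (body s).val).val →
      RepeatUntil body done (body s).val r →
      RepeatUntil body done s
        ⟨r.val, (body s).calls + (done (body s).val).calls + r.calls⟩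

/-! ### The algorithms -/

/-- Nesterov's accelerated gradient descent AGD: `T` steps from `x₀`, with smoothness constant `l`
and strong convexity modulus `μ`, for the function with gradient oracle `G`.  The loop state is
`(x_t, x̃_t)`. -/
noncomputable def agd {d : ℕ} (G : Vec d → Counted (Vec d)) (l μ : ℝ) (T : ℕ) (x₀ : Vec d) :
    Counted (Vec d) := do
  let η : ℝ := 1 / l
  let κ : ℝ := l / μ
  let θ : ℝ := (√κ - 1) / (√κ + 1)
  let s ← forLoop (fun s : Vec d × Vec d => do
      let g ← G s.2
      let x : Vec d := s.2 - η • g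
      pure (x, x + θ • (x - s.1))) T (x₀, x₀)
  pure s.1

/-- Alternating Best Response ABR(`g`, `z₀`, `ε`, `mₓ`, `m_y`, `Lₓ`, `L_y`), where `O` is the
gradient oracle of `g`. -/
noncomputable def abr {n m : ℕ} (O : Oracle n m) (z₀ : Pt n m) (ε mx my Lx Ly : ℝ) :
    Counted (Pt n m) :=
  let κx : ℝ := Lx / mx
  let κy : ℝ := Ly / my
  let T : ℕ := ⌈Real.logb 2 (4 * √(κx + κy) / ε)⌉₊
  forLoop (fun z => do
      let x ← agd (fun x => do let g ← O (x, z.2); pure g.1) Lx mx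
        ⌈2 * √κx * Real.log (24 * κx)⌉₊ z.1
      let y ← agd (fun y => do let g ← O (x, y); pure (-g.2)) Ly my
        ⌈2 * √κy * Real.log (24 * κy)⌉₊ z.2
      pure (x, y)) T z₀

/-- The oracle of `g(x, y) + β‖x - x̂‖²`, given the oracle of `g`. -/
noncomputable def proxX {n m : ℕ} (O : Oracle n m) (β : ℝ) (xhat : Vec n) : Oracle n m :=
  fun z => do
    let g ← O z
    pure (g.1 + (2 * β) • (z.1 - xhat), g.2)

/-- The oracle of `g(x, y) - β‖y - ŷ‖²`, given the oracle of `g`. -/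
noncomputable def proxY {n m : ℕ} (O : Oracle n m) (β : ℝ) (yhat : Vec m) : Oracle n m :=
  fun z => do
    let g ← O z
    pure (g.1, g.2 - (2 * β) • (z.2 - yhat))

/-- `θ = (2√κ - 1) / (2√κ + 1)`. -/
noncomputable def theta (κ : ℝ) : ℝ := (2 * √κ - 1) / (2 * √κ + 1)

/-- `τ = 1 / (2√κ + 4κ)`. -/
noncomputable def tau (κ : ℝ) : ℝ := 1 / (2 * √κ + 4 * κ)

/-- The extrapolation `û_t = u_t + θ(u_t - u_{t-1}) + τ(u_t - û_{t-1})`. -/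
noncomputable def extrapolate {d : ℕ} (κ : ℝ) (uprev uhat u : Vec d) : Vec d :=
  u + theta κ • (u - uprev) + tau κ • (u - uhat)

/-- `β₁ = max {mₓ, Lₓᵧ}`. -/
noncomputable def Params.β₁ (p : Params) : ℝ := max p.mx p.Lxy

/-- `β₂ = max {m_y, Lₓᵧ}`. -/
noncomputable def Params.β₂ (p : Params) : ℝ := max p.my p.Lxy

/-- `M₁ = 80 L³ / (mₓ^1.5 m_y^1.5)`. -/
noncomputable def Params.M₁ (p : Params) : ℝ :=
  80 * p.L ^ 3 / (p.mx ^ (3 / 2 : ℝ) * p.my ^ (3 / 2 : ℝ))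

/-- `M₂ = 96 L^2.5 / (mₓ m_y^1.5)`. -/
noncomputable def Params.M₂ (p : Params) : ℝ :=
  96 * p.L ^ (5 / 2 : ℝ) / (p.mx * p.my ^ (3 / 2 : ℝ))

/-- One iteration of APPA-ABR; the state is `((x_t, y_t), ŷ_t)`. -/
noncomputable def appaBody {n m : ℕ} (p : Params) (O : Oracle n m) (s : Pt n m × Vec m) :
    Counted (Pt n m × Vec m) := do
  let z ← abr (proxY O p.β₂ s.2) s.1 (1 / p.M₂) (2 * p.β₁) (2 * p.β₂) (3 * p.L) (3 * p.L)
  pure (z, extrapolate (p.β₂ / p.my) s.1.2 s.2 z.2)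

/-- The stopping test
`‖∇g(x_t, y_t)‖ ≤ min {mₓ, m_y} / (9 L M₁) · ‖∇g(x₀, y₀)‖` of APPA-ABR, which costs the evaluation
of `∇g(x_t, y_t)`; `g₀` is the value of `∇g(x₀, y₀)`. -/
noncomputable def appaDone {n m : ℕ} (p : Params) (M₁ : ℝ) (O : Oracle n m) (g₀ : Pt n m)
    (s : Pt n m × Vec m) : Counted Prop := do
  let g ← O s.1
  pure (enorm2 g ≤ min p.mx p.my / (9 * p.L * M₁) * enorm2 g₀)

/-- `AppaAbr p O z₀ M₁ r`: the call APPA-ABR(`g`, `z₀`, `M₁`), where `O` is the gradient oracle of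
`g`, terminates with the result `r`. -/
def AppaAbr {n m : ℕ} (p : Params) (O : Oracle n m) (z₀ : Pt n m) (M₁ : ℝ)
    (r : Counted (Pt n m)) : Prop :=
  ∃ q : Counted (Pt n m × Vec m),
    RepeatUntil (appaBody p O) (appaDone p M₁ O (O z₀).val) (z₀, z₀.2) q ∧
      r = ⟨q.val.1, (O z₀).calls + q.calls⟩

/-- `PbrRun p O z₀ t r`: Proximal Best Response, run from `z₀` on the function with gradient
oracle `O`, completes `t` iterations; `r.val = ((x_t, y_t), x̂_t)` is the state it is in then, and
`r.calls` is the number of gradient evaluations it has made. -/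
inductive PbrRun {n m : ℕ} (p : Params) (O : Oracle n m) (z₀ : Pt n m) :
    ℕ → Counted (Pt n m × Vec n) → Prop
  | init : PbrRun p O z₀ 0 ⟨(z₀, z₀.1), 0⟩
  | step (t : ℕ) (s : Counted (Pt n m × Vec n)) (r : Counted (Pt n m)) :
      PbrRun p O z₀ t s →
      AppaAbr p (proxX O p.β₁ s.val.2) s.val.1 p.M₁ r →
      PbrRun p O z₀ (t + 1)
        ⟨(r.val, extrapolate (p.β₁ / p.mx) s.val.1.1 s.val.2 r.val.1), s.calls + r.calls⟩

/-! ### The normalization `Lₓ = L_y`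

The algorithm is formulated for `Lₓ = L_y`.  In general it is applied to
`g(x, y) = f((L_y/Lₓ)^(1/4) x, (Lₓ/L_y)^(1/4) y)`, for which the two constants agree.  If `Lₓ = L_y`
already, both factors are `1` and `g = f`. -/

/-- `(L_y/Lₓ)^(1/4)`. -/
noncomputable def Params.ax (p : Params) : ℝ := (p.Ly / p.Lx) ^ (1 / 4 : ℝ)

/-- `(Lₓ/L_y)^(1/4)`. -/
noncomputable def Params.ay (p : Params) : ℝ := (p.Lx / p.Ly) ^ (1 / 4 : ℝ)

/-- The constants of the rescaled function `g`. -/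
noncomputable def Params.rescale (p : Params) : Params where
  mx := p.ax ^ 2 * p.mx
  my := p.ay ^ 2 * p.my
  Lx := p.ax ^ 2 * p.Lx
  Lxy := p.ax * p.ay * p.Lxy
  Ly := p.ay ^ 2 * p.Ly

/-- The oracle of `g`, given the oracle of `f`. -/
noncomputable def rescaleOracle {n m : ℕ} (p : Params) (O : Oracle n m) : Oracle n m :=
  fun z => do
    let g ← O (p.ax • z.1, p.ay • z.2)
    pure (p.ax • g.1, p.ay • g.2)

/-- `ProximalBestResponse p f z₀ T r`: Proximal Best Response, run on `f` from `z₀ = [x₀; y₀]` for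
`T` iterations, produces the point `r.val = z_T` with `r.calls` evaluations of the gradient of
`f`. -/
def ProximalBestResponse {n m : ℕ} (p : Params) (f : Vec n → Vec m → ℝ) (z₀ : Pt n m) (T : ℕ)
    (r : Counted (Pt n m)) : Prop :=
  ∃ s : Counted (Pt n m × Vec n),
    PbrRun p.rescale (rescaleOracle p (gradOracle f)) (p.ax⁻¹ • z₀.1, p.ay⁻¹ • z₀.2) T s ∧
      r = ⟨(p.ax • s.val.1.1, p.ay • s.val.1.2), s.calls⟩

end Minimax

/-! The method is three nested loops. Each has a quantity that decreases geometrically, and the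
complexity is the product of the three rates.

Innermost, `f + β₁‖x - x̂‖² - β₂‖y - ŷ‖²` has moduli at least `2β₁` and `2β₂`. Since `Lxy² ≤ β₁β₂`,
both best-response maps halve distances once the norms are weighted by the square roots of the
moduli. Alternating approximate best responses therefore converge at a constant rate, and one
response costs AGD about `√(L/βᵢ)` steps (`agd_contract`, `abr_contract`).

The two outer loops remove the regularization, one variable at a time, by the same argument. With
the best response `r`, the envelope `x ↦ f(x, r x)` is strongly convex with gradient `∇ₓ f(x, r x)`
(`envelope_cvx`), and its proximal subproblem is the saddle problem of the regularized function. The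
choice of `θ` and `τ` makes the iteration an inexact accelerated proximal point method with `α =
1/(2√κ)` (`auxPoint_extrapolate`). The potential of `proxPotential_step` also records how far the
second variable is from the response. It contracts by `1 - α/2` as soon as each subproblem solver
shrinks the distance to the subproblem's solution by a fixed factor `δ`. Accuracy is thus relative
to a warm start, and `δ = 1/M₁`, `1/M₂` are negative powers of condition numbers that cost only
logarithms. The inner loop is the same statement for the swapped function. Its gradient test fires
in time and certifies the relative accuracy (`appaAbr_exists`).

Up to logarithms the cost is `√(β₁/mx) √(β₂/my) (√(L/β₁) + √(L/β₂))`. In each product one `βᵢ`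
cancels, and `β₁ ≤ mx + Lxy`, `β₂ ≤ my + Lxy` give the root of `L/mx + L Lxy/(mx my) + L/my`
(`sqrt_kappa_mul_le`). The rescaling that equalizes `Lx` and `Ly` then improves the outer two terms
to `Lx/mx` and `Ly/my` (`rescale_complexity_le`). The cubed logarithm comes from the AGD steps, the
ABR rounds and the APPA-ABR iterations; the last logarithm counts the outermost loop. -/

namespace Minimax

/-! ### Estimate sequences, zeros of monotone maps and the descent lemma in a Hilbert space. -/

section Hilbert

variable {E : Type*} [NormedAddCommGroup E] [InnerProductSpace ℝ E]

/-- The basic estimate-sequence inequality behind accelerated gradient and proximal methods. -/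
theorem estimate_step {α μ hq hx hs : ℝ} {g x xs q v : E} (hμ : 0 < μ) (hα0 : 0 ≤ α)
    (hα1 : α ≤ 1) (h1 : hq + inner ℝ g (x - q) ≤ hx)
    (h2 : hq + inner ℝ g (xs - q) + μ / 2 * ‖xs - q‖ ^ 2 ≤ hs) :
    hq - hs + μ / 2 * ‖(1 - α) • v + α • q - (α / μ) • g - xs‖ ^ 2 ≤
      (1 - α) * (hx - hs + μ / 2 * ‖v - xs‖ ^ 2) + α ^ 2 / (2 * μ) * ‖g‖ ^ 2
        - (1 - α) * inner ℝ g (x + α • v - (1 + α) • q) := by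
  have e1 : (1 - α) • v + α • q - (α / μ) • g - xs
      = (1 - α) • (v - xs) + α • (q - xs) - (α / μ) • g := by module
  have e2 : x + α • v - (1 + α) • q = (x - q) + α • (v - xs) - α • (q - xs) := by module
  have e3 : xs - q = -(q - xs) := by abel
  rw [e1, e2]
  rw [e3, norm_neg, inner_neg_right] at h2
  generalize v - xs = a at *
  generalize q - xs = b at *
  generalize x - q = c at *
  -- `α(1 - α)‖a - b‖²` is the convexity defect of the squared norm at `(1 - α) a + α b`. The claim
  -- is the combination of `h1` and `h2` with weights `1 - α` and `α`, plus this defect.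
  have h3 : 0 ≤ ‖a - b‖ ^ 2 := by positivity
  rw [← real_inner_self_eq_norm_sq] at h3
  simp only [← real_inner_self_eq_norm_sq] at h2 ⊢
  simp only [inner_add_left, inner_add_right, inner_sub_left, inner_sub_right,
    real_inner_smul_left, real_inner_smul_right] at h3 ⊢
  rw [real_inner_comm a b, real_inner_comm g b, real_inner_comm g a] at *
  have h3' := mul_nonneg (by positivity : 0 ≤ μ / 2 * α) (mul_nonneg (sub_nonneg.2 hα1) h3)
  have h1' := mul_le_mul_of_nonneg_left h1 (sub_nonneg.2 hα1)
  have h2' := mul_le_mul_of_nonneg_left h2 hα0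
  have e4 : α / μ * (α / μ * inner ℝ g g) * (μ / 2) = α ^ 2 / (2 * μ) * inner ℝ g g := by
    field_simp
  have e5 : ∀ t : ℝ, α / μ * t * (μ / 2) = α / 2 * t := by intro t; field_simp
  have e6 := e5 (inner ℝ g a)
  have e7 := e5 (inner ℝ g b)
  linear_combination h3' + h1' + h2' + e4 - 2 * (1 - α) * e6 - 2 * α * e7

/-- A strongly monotone Lipschitz map of a Hilbert space has a zero. -/
theorem exists_zero_of_stronglyMonotone [CompleteSpace E] {F : E → E} {μ L : ℝ} (hμ : 0 < μ)
    (hmono : ∀ u v, μ * ‖u - v‖ ^ 2 ≤ inner ℝ (F u - F v) (u - v))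
    (hlip : ∀ u v, ‖F u - F v‖ ≤ L * ‖u - v‖) : ∃ u, F u = 0 := by
  -- `L` may be negative, and `K ≥ μ` keeps the factor `1 - μ²/K²` nonnegative. With `η = μ/K²`, the
  -- map `u ↦ u - η F u` is then a contraction whose fixed points are the zeros of `F`.
  obtain ⟨K, hK, hKμ⟩ : ∃ K : ℝ, 0 < K ∧ (L ^ 2 ≤ K ^ 2 ∧ μ ≤ K) :=
    ⟨max |L| μ, lt_max_of_lt_right hμ, by
      rw [← sq_abs L]; gcongr; exact le_max_left _ _, le_max_right _ _⟩
  set η : ℝ := μ / K ^ 2 with hη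
  have hη0 : 0 < η := by positivity
  have hstep : ∀ u v, ‖(u - η • F u) - (v - η • F v)‖ ^ 2 ≤ (1 - η * μ) * ‖u - v‖ ^ 2 := by
    intro u v
    have e : (u - η • F u) - (v - η • F v) = (u - v) - η • (F u - F v) := by module
    rw [e, norm_sub_sq_real, norm_smul, real_inner_smul_right, real_inner_comm,
      Real.norm_of_nonneg hη0.le, mul_pow]
    have h1 : ‖F u - F v‖ ^ 2 ≤ K ^ 2 * ‖u - v‖ ^ 2 := by
      calc ‖F u - F v‖ ^ 2 ≤ (L * ‖u - v‖) ^ 2 := by gcongr; exact hlip u v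
        _ = L ^ 2 * ‖u - v‖ ^ 2 := by ring
        _ ≤ _ := mul_le_mul_of_nonneg_right hKμ.1 (by positivity)
    have h2 := mul_le_mul_of_nonneg_left (hmono u v) hη0.le
    have h3 := mul_le_mul_of_nonneg_left h1 (sq_nonneg η)
    have h4 : η ^ 2 * (K ^ 2 * ‖u - v‖ ^ 2) = η * μ * ‖u - v‖ ^ 2 := by
      rw [hη]; field_simp
    linarith
  have hc0 : 0 ≤ 1 - η * μ := by
    rw [sub_nonneg, hη, div_mul_eq_mul_div, div_le_one (by positivity)]
    nlinarith
  have hc1 : √(1 - η * μ) < 1 := by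
    rw [Real.sqrt_lt' one_pos]
    have : 0 < η * μ := by positivity
    linarith
  have hcontr : ContractingWith (NNReal.mk √(1 - η * μ) (Real.sqrt_nonneg _))
      (fun u => u - η • F u) := by
    refine ⟨by exact_mod_cast hc1, LipschitzWith.of_dist_le_mul fun u v => ?_⟩
    rw [dist_eq_norm, dist_eq_norm]
    refine abs_le_of_sq_le_sq' ?_ (by positivity) |>.2
    rw [mul_pow, NNReal.coe_mk, Real.sq_sqrt hc0]
    exact hstep u v
  obtain ⟨u, hu, -⟩ := hcontr.exists_fixedPoint 0 (edist_ne_top _ _)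
  refine ⟨u, ?_⟩
  have hu' : u - η • F u = u := hu
  have : η • F u = 0 := by simpa using hu'
  exact (smul_eq_zero.1 this).resolve_left hη0.ne'

/-- The descent lemma: a function with `l`-Lipschitz gradient lies below its quadratic model. -/
theorem le_quadratic_of_lipschitz_gradient [CompleteSpace E] {h : E → ℝ} {l : ℝ}
    (hd : Differentiable ℝ h)
    (hl : ∀ u v, ‖gradient h u - gradient h v‖ ≤ l * ‖u - v‖) (u v : E) :
    h v ≤ h u + inner ℝ (gradient h u) (v - u) + l / 2 * ‖v - u‖ ^ 2 := by
  set d := v - u with hdd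
  let φ : ℝ → ℝ := fun t => h (u + t • d) - t * inner ℝ (gradient h u) d - l / 2 * t ^ 2 * ‖d‖ ^ 2
  have hφ : ∀ t, HasDerivAt φ (inner ℝ (gradient h (u + t • d)) d
      - inner ℝ (gradient h u) d - l * t * ‖d‖ ^ 2) t := by
    intro t
    have h1 : HasDerivAt (fun t : ℝ => u + t • d) d t := by
      simpa using ((hasDerivAt_id t).smul_const d).const_add u
    have h2 := (hd (u + t • d)).hasFDerivAt.comp_hasDerivAt t h1
    rw [← inner_gradient_left] at h2
    have h3 := ((h2.sub ((hasDerivAt_id t).mul_const (inner ℝ (gradient h u) d))).sub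
      ((((hasDerivAt_id t).pow 2).const_mul (l / 2)).mul_const (‖d‖ ^ 2)))
    refine HasDerivAt.congr_deriv (f := φ) h3 ?_
    simp only [id_eq, Nat.cast_ofNat]
    ring
  have hanti : AntitoneOn φ (Set.Icc 0 1) := by
    refine antitoneOn_of_deriv_nonpos (convex_Icc 0 1)
      (fun t _ => (hφ t).continuousAt.continuousWithinAt)
      (fun t _ => (hφ t).differentiableAt.differentiableWithinAt) fun t ht => ?_
    rw [interior_Icc] at ht
    rw [(hφ t).deriv, ← inner_sub_left]
    have h1 := real_inner_le_norm (gradient h (u + t • d) - gradient h u) d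
    have h2 := hl (u + t • d) u
    rw [add_sub_cancel_left, norm_smul, Real.norm_of_nonneg ht.1.le] at h2
    have h3 := mul_le_mul_of_nonneg_right h2 (norm_nonneg d)
    nlinarith
  have := hanti (by simp) (by simp) (zero_le_one' ℝ)
  simp only [φ, one_smul, zero_smul, add_zero] at this
  have e : u + d = v := by simp [hdd]
  rw [e] at this
  linarith

end Hilbert

/-! ### Loops -/

@[simp] theorem Counted.bind_val {α β : Type} (c : Counted α) (k : α → Counted β) :
    (c >>= k).val = (k c.val).val := rfl

@[simp] theorem Counted.bind_calls {α β : Type} (c : Counted α) (k : α → Counted β) :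
    (c >>= k).calls = c.calls + (k c.val).calls := rfl

@[simp] theorem Counted.pure_val {α : Type} (a : α) : (pure a : Counted α).val = a := rfl

@[simp] theorem Counted.pure_calls {α : Type} (a : α) : (pure a : Counted α).calls = 0 := rfl

theorem forLoop_potential {σ : Type} {body : σ → Counted σ} {Φ : σ → ℝ} {ρ : ℝ} (hρ : 0 ≤ ρ)
    (h : ∀ s, Φ (body s).val ≤ ρ * Φ s) (T : ℕ) (s : σ) :
    Φ (forLoop body T s).val ≤ ρ ^ T * Φ s := by
  induction T generalizing s with
  | zero => simp [forLoop]
  | succ T ih =>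
    refine (ih (body s).val).trans ?_
    rw [pow_succ, mul_assoc]
    exact mul_le_mul_of_nonneg_left (h s) (by positivity)

theorem forLoop_calls {σ : Type} {body : σ → Counted σ} {k : ℕ}
    (h : ∀ s, (body s).calls = k) (T : ℕ) (s : σ) : (forLoop body T s).calls = T * k := by
  induction T generalizing s with
  | zero => simp [forLoop]
  | succ T ih =>
    simp only [forLoop, Counted.bind_calls, h, ih]
    ring

/-! ### Accelerated gradient descent. -/

theorem agd_calls {d : ℕ} {G : Vec d → Counted (Vec d)} (hG : ∀ x, (G x).calls = 1) (l μ : ℝ)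
    (T : ℕ) (x₀ : Vec d) : (agd G l μ T x₀).calls = T := by
  simp only [agd, Counted.bind_calls, Counted.pure_calls]
  rw [forLoop_calls (k := 1) (by intro s; simp [hG])]
  simp

/-- Accelerated gradient descent contracts the usual Lyapunov function by `1 - √(μ/l)` per step. -/
theorem agd_potential {d : ℕ} {h : Vec d → ℝ} {g : Vec d → Vec d} {G : Vec d → Counted (Vec d)}
    (hG : ∀ x, (G x).val = g x) {l μ : ℝ} (hμ : 0 < μ) (hl : μ ≤ l)
    (hcvx : ∀ u v, h u + inner ℝ (g u) (v - u) + μ / 2 * ‖v - u‖ ^ 2 ≤ h v)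
    (hsm : ∀ u v, h v ≤ h u + inner ℝ (g u) (v - u) + l / 2 * ‖v - u‖ ^ 2)
    {xs : Vec d} (hxs : g xs = 0) (T : ℕ) (x₀ : Vec d) :
    μ / 2 * ‖(agd G l μ T x₀).val - xs‖ ^ 2 ≤ (1 - 1 / √(l / μ)) ^ T * (l * ‖x₀ - xs‖ ^ 2) := by
  have hl0 : 0 < l := hμ.trans_le hl
  have hκ : 1 ≤ √(l / μ) := by
    rw [Real.one_le_sqrt, le_div_iff₀ hμ]; linarith
  set α : ℝ := 1 / √(l / μ) with hα
  have hα0 : 0 < α := by positivity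
  have hα1 : α ≤ 1 := by rw [hα, div_le_one (by positivity)]; exact hκ
  have hα2 : α ^ 2 = μ / l := by
    rw [hα, div_pow, Real.sq_sqrt (by positivity), one_pow, one_div, inv_div]
  have hθ : (√(l / μ) - 1) / (√(l / μ) + 1) = (1 - α) / (1 + α) := by
    rw [hα]; field_simp
  -- The second term contains the auxiliary point `v` of the estimate sequence, recovered from the
  -- loop state by solving `(1 + α) x̃ = x + α v`.
  let Φ : Vec d × Vec d → ℝ := fun s =>
    h s.1 - h xs + μ / 2 * ‖α⁻¹ • ((1 + α) • s.2 - s.1) - xs‖ ^ 2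
  have hmin : ∀ x, μ / 2 * ‖x - xs‖ ^ 2 ≤ h x - h xs := by
    intro x
    have := hcvx xs x
    rw [hxs, inner_zero_left] at this
    linarith
  have key := forLoop_potential (Φ := Φ) (ρ := 1 - α) (body := fun s : Vec d × Vec d => do
      let g ← G s.2
      let x : Vec d := s.2 - (1 / l) • g
      pure (x, x + ((√(l / μ) - 1) / (√(l / μ) + 1)) • (x - s.1))) (by linarith) (by
    intro ⟨x, p⟩
    simp only [Counted.bind_val, Counted.pure_val, hG, Φ, hθ]
    have h1 := hcvx p x
    have h2 := hcvx p xs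
    have h1' : h p + inner ℝ (g p) (x - p) ≤ h x := by
      have : 0 ≤ μ / 2 * ‖x - p‖ ^ 2 := by positivity
      linarith
    have hest := estimate_step (v := α⁻¹ • ((1 + α) • p - x)) hμ hα0.le hα1 h1' h2
    have ev : α⁻¹ • ((1 + α) • (p - (1 / l) • g p + ((1 - α) / (1 + α)) •
        (p - (1 / l) • g p - x)) - (p - (1 / l) • g p))
        = (1 - α) • α⁻¹ • ((1 + α) • p - x) + α • p - (α / μ) • g p := by
      have : α / μ = α⁻¹ * (1 / l) := by
        field_simp; rw [hα2]; field_simp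
      rw [this]
      match_scalars <;> field_simp <;> ring
    rw [ev]
    -- The extrapolation is chosen so that this vector vanishes. Since `α² = μ/l`, the remaining
    -- gradient term of `estimate_step` equals the decrease guaranteed by the descent lemma.
    have e0 : x + α • α⁻¹ • ((1 + α) • p - x) - (1 + α) • p = 0 := by
      rw [smul_inv_smul₀ hα0.ne']; abel
    rw [e0, inner_zero_right, mul_zero, sub_zero, hα2] at hest
    have hd := hsm p (p - (1 / l) • g p)
    have e1 : p - (1 / l) • g p - p = -((1 / l) • g p) := by abel
    rw [e1, inner_neg_right, norm_neg, norm_smul, real_inner_smul_right,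
      real_inner_self_eq_norm_sq, Real.norm_of_nonneg (by positivity)] at hd
    have e2 : l / 2 * (1 / l * ‖g p‖) ^ 2 = 1 / (2 * l) * ‖g p‖ ^ 2 := by field_simp
    have e3 : μ / l / (2 * μ) * ‖g p‖ ^ 2 = 1 / (2 * l) * ‖g p‖ ^ 2 := by field_simp
    have e4 : 1 / l * ‖g p‖ ^ 2 = 2 * (1 / (2 * l) * ‖g p‖ ^ 2) := by field_simp
    rw [e2, e4] at hd
    rw [e3] at hest
    linarith) T (x₀, x₀)
  have h0 : Φ (x₀, x₀) ≤ l * ‖x₀ - xs‖ ^ 2 := by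
    have e : α⁻¹ • ((1 + α) • x₀ - x₀) = x₀ := by
      match_scalars; field_simp; ring
    have h1 := hsm xs x₀
    rw [hxs, inner_zero_left] at h1
    simp only [Φ, e]
    nlinarith [sq_nonneg ‖x₀ - xs‖]
  have h3 : ∀ s, μ / 2 * ‖s.1 - xs‖ ^ 2 ≤ Φ s := by
    intro s
    have : 0 ≤ μ / 2 * ‖α⁻¹ • ((1 + α) • s.2 - s.1) - xs‖ ^ 2 := by positivity
    have := hmin s.1
    simp only [Φ]; linarith
  refine (h3 _).trans (key.trans ?_)
  exact mul_le_mul_of_nonneg_left h0 (pow_nonneg (by linarith) _)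

/-- With the step count used by ABR, accelerated gradient descent reduces the distance to the
minimizer by a factor `16`. -/
theorem agd_contract {d : ℕ} {h : Vec d → ℝ} {g : Vec d → Vec d} {G : Vec d → Counted (Vec d)}
    (hG : ∀ x, (G x).val = g x) {l μ : ℝ} (hμ : 0 < μ) (hl : μ ≤ l)
    (hcvx : ∀ u v, h u + inner ℝ (g u) (v - u) + μ / 2 * ‖v - u‖ ^ 2 ≤ h v)
    (hsm : ∀ u v, h v ≤ h u + inner ℝ (g u) (v - u) + l / 2 * ‖v - u‖ ^ 2)
    {xs : Vec d} (hxs : g xs = 0) (x₀ : Vec d) :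
    ‖(agd G l μ ⌈2 * √(l / μ) * Real.log (24 * (l / μ))⌉₊ x₀).val - xs‖
      ≤ 1 / 16 * ‖x₀ - xs‖ := by
  set T := ⌈2 * √(l / μ) * Real.log (24 * (l / μ))⌉₊ with hT
  have key := agd_potential hG hμ hl hcvx hsm hxs T x₀
  have hκ1 : 1 ≤ l / μ := by rw [le_div_iff₀ hμ]; linarith
  have hlκ : l = l / μ * μ := by field_simp
  generalize hκ : l / μ = κ at *
  have hs1 : 1 ≤ √κ := Real.one_le_sqrt.2 hκ1
  -- The factor `2` in the step count squares `24κ`: one `κ` pays for `l/μ`, and `576 ≥ 2 · 16²`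
  -- leaves the factor `1/16` in the distance.
  have hrate : (1 - 1 / √κ) ^ T ≤ 1 / (24 * κ) ^ 2 := by
    calc (1 - 1 / √κ) ^ T ≤ (Real.exp (-(1 / √κ))) ^ T := by
          gcongr
          · rw [sub_nonneg, div_le_one (by positivity)]; exact hs1
          · have := Real.add_one_le_exp (-(1 / √κ)); linarith
      _ = Real.exp (-(T / √κ)) := by rw [← Real.exp_nat_mul]; ring_nf
      _ ≤ Real.exp (-(2 * Real.log (24 * κ))) := by
          gcongr
          rw [le_div_iff₀ (by positivity)]
          have := Nat.le_ceil (2 * √κ * Real.log (24 * κ))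
          rw [← hT] at this
          linarith
      _ = 1 / (24 * κ) ^ 2 := by
          rw [Real.exp_neg, two_mul, Real.exp_add, Real.exp_log (by positivity)]
          rw [one_div, sq]
  have h2 : μ / 2 * ‖(agd G l μ T x₀).val - xs‖ ^ 2 ≤ μ / 2 * (1 / 16 * ‖x₀ - xs‖) ^ 2 := by
    refine key.trans ?_
    calc (1 - 1 / √κ) ^ T * (l * ‖x₀ - xs‖ ^ 2)
        ≤ 1 / (24 * κ) ^ 2 * (l * ‖x₀ - xs‖ ^ 2) := by
          exact mul_le_mul_of_nonneg_right hrate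
            (mul_nonneg (hμ.trans_le hl).le (sq_nonneg _))
      _ = μ * ‖x₀ - xs‖ ^ 2 * (1 / (576 * κ)) := by rw [hlκ]; field_simp; ring
      _ ≤ μ * ‖x₀ - xs‖ ^ 2 * (1 / 512) := by
          gcongr
          linarith
      _ = _ := by ring
  have h3 : ‖(agd G l μ T x₀).val - xs‖ ^ 2 ≤ (1 / 16 * ‖x₀ - xs‖) ^ 2 :=
    le_of_mul_le_mul_left h2 (by positivity)
  exact abs_le_of_sq_le_sq' h3 (by positivity) |>.2

end Minimax
namespace Minimax

/-! ### The Euclidean norm of pairs -/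

theorem enorm2_nonneg {n m : ℕ} (z : Pt n m) : 0 ≤ enorm2 z := norm_nonneg _

theorem enorm2_sq {n m : ℕ} (z : Pt n m) : enorm2 z ^ 2 = ‖z.1‖ ^ 2 + ‖z.2‖ ^ 2 := by
  rw [enorm2, WithLp.prod_norm_sq_eq_of_L2]
  rfl

theorem enorm2_le_of_sq_le {n m k l : ℕ} {z : Pt n m} {w : Pt k l} {c : ℝ} (hc : 0 ≤ c)
    (h : enorm2 z ^ 2 ≤ c ^ 2 * enorm2 w ^ 2) : enorm2 z ≤ c * enorm2 w := by
  rw [← mul_pow] at h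
  exact abs_le_of_sq_le_sq' h (mul_nonneg hc (enorm2_nonneg w)) |>.2

/-! ### Strongly convex-concave smooth functions -/

/-- The inequalities satisfied by a function in `𝓕` and its partial gradients `gx`, `gy`. -/
structure SaddleClass {n m : ℕ} (f : Vec n → Vec m → ℝ) (gx : Vec n → Vec m → Vec n)
    (gy : Vec n → Vec m → Vec m) (mx my Lx Lxy Ly : ℝ) : Prop where
  cvx : ∀ x x' y, f x y + inner ℝ (gx x y) (x' - x) + mx / 2 * ‖x' - x‖ ^ 2 ≤ f x' y
  ccv : ∀ x y y', f x y' ≤ f x y + inner ℝ (gy x y) (y' - y) - my / 2 * ‖y' - y‖ ^ 2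
  smx : ∀ x x' y, f x' y ≤ f x y + inner ℝ (gx x y) (x' - x) + Lx / 2 * ‖x' - x‖ ^ 2
  smy : ∀ x y y', f x y + inner ℝ (gy x y) (y' - y) - Ly / 2 * ‖y' - y‖ ^ 2 ≤ f x y'
  lip_xx : ∀ x x' y, ‖gx x y - gx x' y‖ ≤ Lx * ‖x - x'‖
  lip_yy : ∀ x y y', ‖gy x y - gy x y'‖ ≤ Ly * ‖y - y'‖
  lip_xy : ∀ x y y', ‖gx x y - gx x y'‖ ≤ Lxy * ‖y - y'‖
  lip_yx : ∀ x x' y, ‖gy x y - gy x' y‖ ≤ Lxy * ‖x - x'‖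

namespace SaddleClass

variable {n m : ℕ} {f : Vec n → Vec m → ℝ} {gx : Vec n → Vec m → Vec n}
  {gy : Vec n → Vec m → Vec m} {mx my Lx Lxy Ly : ℝ}

/-- Negation exchanges the two players. Every statement about `x` yields its twin for `y`, and the
proximal loop in `y` becomes one in the first variable. -/
theorem swap (h : SaddleClass f gx gy mx my Lx Lxy Ly) :
    SaddleClass (fun y x => -f x y) (fun y x => -gy x y) (fun y x => -gx x y)
      my mx Ly Lxy Lx where
  cvx y y' x := by have := h.ccv x y y'; rw [inner_neg_left]; linarith
  ccv y x x' := by have := h.cvx x x' y; rw [inner_neg_left]; linarith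
  smx y y' x := by have := h.smy x y y'; rw [inner_neg_left]; linarith
  smy y x x' := by have := h.smx x x' y; rw [inner_neg_left]; linarith
  lip_xx y y' x := by rw [← neg_sub', norm_neg]; exact h.lip_yy x y y'
  lip_yy y x x' := by rw [← neg_sub', norm_neg]; exact h.lip_xx x x' y
  lip_xy y x x' := by rw [← neg_sub', norm_neg]; exact h.lip_yx x x' y
  lip_yx y y' x := by rw [← neg_sub', norm_neg]; exact h.lip_xy x y y'

theorem mono (h : SaddleClass f gx gy mx my Lx Lxy Ly) {mx' my' Lx' Lxy' Ly' : ℝ}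
    (h1 : mx' ≤ mx) (h2 : my' ≤ my) (h3 : Lx ≤ Lx') (h4 : Lxy ≤ Lxy') (h5 : Ly ≤ Ly') :
    SaddleClass f gx gy mx' my' Lx' Lxy' Ly' where
  cvx x x' y := by
    have := h.cvx x x' y
    have : mx' / 2 * ‖x' - x‖ ^ 2 ≤ mx / 2 * ‖x' - x‖ ^ 2 := by gcongr
    linarith
  ccv x y y' := by
    have := h.ccv x y y'
    have : my' / 2 * ‖y' - y‖ ^ 2 ≤ my / 2 * ‖y' - y‖ ^ 2 := by gcongr
    linarith
  smx x x' y := by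
    have := h.smx x x' y
    have : Lx / 2 * ‖x' - x‖ ^ 2 ≤ Lx' / 2 * ‖x' - x‖ ^ 2 := by gcongr
    linarith
  smy x y y' := by
    have := h.smy x y y'
    have : Ly / 2 * ‖y' - y‖ ^ 2 ≤ Ly' / 2 * ‖y' - y‖ ^ 2 := by gcongr
    linarith
  lip_xx x x' y := (h.lip_xx x x' y).trans (by gcongr)
  lip_yy x y y' := (h.lip_yy x y y').trans (by gcongr)
  lip_xy x y y' := (h.lip_xy x y y').trans (by gcongr)
  lip_yx x x' y := (h.lip_yx x x' y).trans (by gcongr)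

theorem proxX (h : SaddleClass f gx gy mx my Lx Lxy Ly) {β : ℝ} (hβ : 0 ≤ β) (xhat : Vec n) :
    SaddleClass (fun x y => f x y + β * ‖x - xhat‖ ^ 2)
      (fun x y => gx x y + (2 * β) • (x - xhat)) gy (mx + 2 * β) my (Lx + 2 * β) Lxy Ly := by
  have e : ∀ x x' : Vec n, ‖x' - xhat‖ ^ 2
      = ‖x - xhat‖ ^ 2 + 2 * inner ℝ (x - xhat) (x' - x) + ‖x' - x‖ ^ 2 := by
    intro x x'
    rw [← norm_add_sq_real]
    congr 2
    abel
  constructor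
  · intro x x' y
    have := h.cvx x x' y
    rw [e x x', inner_add_left, real_inner_smul_left]
    linarith
  · intro x y y'
    have := h.ccv x y y'
    linarith
  · intro x x' y
    have := h.smx x x' y
    rw [e x x', inner_add_left, real_inner_smul_left]
    linarith
  · intro x y y'
    have := h.smy x y y'
    linarith
  · intro x x' y
    have e' : gx x y + (2 * β) • (x - xhat) - (gx x' y + (2 * β) • (x' - xhat))
        = (gx x y - gx x' y) + (2 * β) • (x - x') := by module
    rw [e', add_mul]
    refine (norm_add_le _ _).trans (add_le_add (h.lip_xx x x' y) ?_)
    rw [norm_smul, Real.norm_of_nonneg (by positivity)]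
  · exact h.lip_yy
  · intro x y y'
    rw [add_sub_add_right_eq_sub]
    exact h.lip_xy x y y'
  · exact h.lip_yx

theorem proxY (h : SaddleClass f gx gy mx my Lx Lxy Ly) {β : ℝ} (hβ : 0 ≤ β) (yhat : Vec m) :
    SaddleClass (fun x y => f x y - β * ‖y - yhat‖ ^ 2) gx
      (fun x y => gy x y - (2 * β) • (y - yhat)) mx (my + 2 * β) Lx Lxy (Ly + 2 * β) := by
  have := (h.swap.proxX hβ yhat).swap
  simp only [neg_neg, neg_add, ← sub_eq_add_neg] at this
  exact this

theorem rescale (h : SaddleClass f gx gy mx my Lx Lxy Ly) {a b : ℝ} (ha : 0 ≤ a) (hb : 0 ≤ b) :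
    SaddleClass (fun x y => f (a • x) (b • y)) (fun x y => a • gx (a • x) (b • y))
      (fun x y => b • gy (a • x) (b • y)) (a ^ 2 * mx) (b ^ 2 * my) (a ^ 2 * Lx) (a * b * Lxy)
      (b ^ 2 * Ly) where
  cvx x x' y := by
    have := h.cvx (a • x) (a • x') (b • y)
    rw [← smul_sub, norm_smul, real_inner_smul_right, Real.norm_of_nonneg ha] at this
    rw [real_inner_smul_left]
    linarith
  ccv x y y' := by
    have := h.ccv (a • x) (b • y) (b • y')
    rw [← smul_sub, norm_smul, real_inner_smul_right, Real.norm_of_nonneg hb] at this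
    rw [real_inner_smul_left]
    linarith
  smx x x' y := by
    have := h.smx (a • x) (a • x') (b • y)
    rw [← smul_sub, norm_smul, real_inner_smul_right, Real.norm_of_nonneg ha] at this
    rw [real_inner_smul_left]
    linarith
  smy x y y' := by
    have := h.smy (a • x) (b • y) (b • y')
    rw [← smul_sub, norm_smul, real_inner_smul_right, Real.norm_of_nonneg hb] at this
    rw [real_inner_smul_left]
    linarith
  lip_xx x x' y := by
    have := mul_le_mul_of_nonneg_left (h.lip_xx (a • x) (a • x') (b • y)) ha
    rw [← smul_sub, norm_smul, Real.norm_of_nonneg ha] at this ⊢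
    linarith
  lip_yy x y y' := by
    have := mul_le_mul_of_nonneg_left (h.lip_yy (a • x) (b • y) (b • y')) hb
    rw [← smul_sub, norm_smul, Real.norm_of_nonneg hb] at this ⊢
    linarith
  lip_xy x y y' := by
    have := mul_le_mul_of_nonneg_left (h.lip_xy (a • x) (b • y) (b • y')) ha
    rw [← smul_sub b, norm_smul, Real.norm_of_nonneg hb] at this
    rw [← smul_sub, norm_smul, Real.norm_of_nonneg ha]
    linarith
  lip_yx x x' y := by
    have := mul_le_mul_of_nonneg_left (h.lip_yx (a • x) (a • x') (b • y)) hb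
    rw [← smul_sub a, norm_smul, Real.norm_of_nonneg ha] at this
    rw [← smul_sub, norm_smul, Real.norm_of_nonneg hb]
    linarith

theorem stronglyMonotone_left (h : SaddleClass f gx gy mx my Lx Lxy Ly) (x x' : Vec n)
    (y : Vec m) : mx * ‖x - x'‖ ^ 2 ≤ inner ℝ (gx x y - gx x' y) (x - x') := by
  have h1 := h.cvx x x' y
  have h2 := h.cvx x' x y
  rw [← neg_sub, inner_neg_right, norm_neg] at h1
  rw [inner_sub_left]
  linarith

/-- The saddle gradient operator is strongly monotone. -/
theorem stronglyMonotone (h : SaddleClass f gx gy mx my Lx Lxy Ly) (x x' : Vec n)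
    (y y' : Vec m) : mx * ‖x - x'‖ ^ 2 + my * ‖y - y'‖ ^ 2 ≤
      inner ℝ (gx x y - gx x' y') (x - x') - inner ℝ (gy x y - gy x' y') (y - y') := by
  have h1 := h.cvx x x' y
  have h2 := h.cvx x' x y'
  have h3 := h.ccv x y y'
  have h4 := h.ccv x' y' y
  rw [← neg_sub, inner_neg_right, norm_neg] at h1
  rw [← neg_sub y y', inner_neg_right, norm_neg] at h3
  rw [inner_sub_left, inner_sub_left]
  linarith

/-- Best responses of the minimizing player exist. -/
theorem exists_response_left (h : SaddleClass f gx gy mx my Lx Lxy Ly) (hmx : 0 < mx) :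
    ∃ r : Vec m → Vec n, ∀ y, gx (r y) y = 0 := by
  choose r hr using fun y => exists_zero_of_stronglyMonotone (F := fun x => gx x y) hmx
    (fun x x' => h.stronglyMonotone_left x x' y) (fun x x' => h.lip_xx x x' y)
  exact ⟨r, hr⟩

/-- Best responses of the maximizing player exist. -/
theorem exists_response (h : SaddleClass f gx gy mx my Lx Lxy Ly) (hmy : 0 < my) :
    ∃ r : Vec n → Vec m, ∀ x, gy x (r x) = 0 := by
  obtain ⟨r, hr⟩ := h.swap.exists_response_left hmy
  exact ⟨r, fun x => neg_eq_zero.1 (hr x)⟩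

theorem lxy_mul_nonneg (h : SaddleClass f gx gy mx my Lx Lxy Ly) (y y' : Vec m) :
    0 ≤ Lxy * ‖y - y'‖ := (norm_nonneg _).trans (h.lip_xy 0 y y')

/-- Strong monotonicity of `∇ₓ f(·, y)` bounds the displacement of the minimizer by the change of
`∇ₓ f` at a fixed point, which is caused by the change of `y` alone. -/
theorem response_left_lipschitz (h : SaddleClass f gx gy mx my Lx Lxy Ly)
    {x x' : Vec n} {y y' : Vec m} (hx : gx x y = 0) (hx' : gx x' y' = 0) :
    mx * ‖x - x'‖ ≤ Lxy * ‖y - y'‖ := by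
  have h1 := h.stronglyMonotone_left x x' y
  rw [hx, ← hx'] at h1
  have h2 := real_inner_le_norm (gx x' y' - gx x' y) (x - x')
  have h3 := h.lip_xy x' y' y
  rw [norm_sub_rev y' y] at h3
  rcases (norm_nonneg (x - x')).eq_or_lt with h0 | h0
  · rw [← h0, mul_zero]; exact h.lxy_mul_nonneg y y'
  · refine le_of_mul_le_mul_right ?_ h0
    calc mx * ‖x - x'‖ * ‖x - x'‖ = mx * ‖x - x'‖ ^ 2 := by ring
      _ ≤ _ := h1.trans (h2.trans (mul_le_mul_of_nonneg_right h3 h0.le))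

theorem response_lipschitz (h : SaddleClass f gx gy mx my Lx Lxy Ly)
    {x x' : Vec n} {y y' : Vec m} (hy : gy x y = 0) (hy' : gy x' y' = 0) :
    my * ‖y - y'‖ ≤ Lxy * ‖x - x'‖ :=
  h.swap.response_left_lipschitz (neg_eq_zero.2 hy) (neg_eq_zero.2 hy')

/-- `x ↦ f(x, r(x)) = max_y f(x, y)` is strongly convex with gradient `∇ₓ f(x, r(x))`. -/
theorem envelope_cvx (h : SaddleClass f gx gy mx my Lx Lxy Ly) (hmy : 0 ≤ my)
    {r : Vec n → Vec m} (hr : ∀ x, gy x (r x) = 0) (x x' : Vec n) :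
    f x (r x) + inner ℝ (gx x (r x)) (x' - x) + mx / 2 * ‖x' - x‖ ^ 2 ≤ f x' (r x') := by
  have h1 := h.cvx x x' (r x)
  -- Optimality of `r x'` gives `f(x', r x) ≤ f(x', r x')`, so the envelope never has to be
  -- differentiated.
  have h2 := h.ccv x' (r x') (r x)
  rw [hr, inner_zero_left] at h2
  have : 0 ≤ my / 2 * ‖r x - r x'‖ ^ 2 := by positivity
  linarith

theorem envelope_lipschitz (h : SaddleClass f gx gy mx my Lx Lxy Ly) (hLxy : 0 ≤ Lxy) {ρ : ℝ}
    {r : Vec n → Vec m} (hr : ∀ x x', ‖r x - r x'‖ ≤ ρ * ‖x - x'‖) (x x' : Vec n) :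
    ‖gx x (r x) - gx x' (r x')‖ ≤ (Lx + Lxy * ρ) * ‖x - x'‖ := by
  have e : gx x (r x) - gx x' (r x')
      = (gx x (r x) - gx x' (r x)) + (gx x' (r x) - gx x' (r x')) := by abel
  rw [e]
  refine (norm_add_le _ _).trans ?_
  have h1 := h.lip_xx x x' (r x)
  have h2 := h.lip_xy x' (r x) (r x')
  have h3 := mul_le_mul_of_nonneg_left (hr x x') hLxy
  linarith

theorem envelope_stronglyMonotone (h : SaddleClass f gx gy mx my Lx Lxy Ly) (hmy : 0 ≤ my)
    {r : Vec n → Vec m} (hr : ∀ x, gy x (r x) = 0) (x x' : Vec n) :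
    mx * ‖x - x'‖ ^ 2 ≤ inner ℝ (gx x (r x) - gx x' (r x')) (x - x') := by
  have h1 := h.envelope_cvx hmy hr x x'
  have h2 := h.envelope_cvx hmy hr x' x
  rw [← neg_sub, inner_neg_right, norm_neg] at h1
  rw [inner_sub_left]
  linarith

/-- Existence of a saddle point. -/
theorem exists_zero (h : SaddleClass f gx gy mx my Lx Lxy Ly) (hmx : 0 < mx) (hmy : 0 < my)
    (hLxy : 0 ≤ Lxy) : ∃ z : Pt n m, gx z.1 z.2 = 0 ∧ gy z.1 z.2 = 0 := by
  obtain ⟨r, hr⟩ := h.exists_response hmy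
  have hl : ∀ x x', ‖r x - r x'‖ ≤ Lxy / my * ‖x - x'‖ := by
    intro x x'
    have := h.response_lipschitz (hr x) (hr x')
    rw [div_mul_eq_mul_div, le_div_iff₀ hmy]; linarith
  obtain ⟨x, hx⟩ := exists_zero_of_stronglyMonotone (F := fun x => gx x (r x)) hmx
    (h.envelope_stronglyMonotone hmy.le hr) (h.envelope_lipschitz hLxy hl)
  exact ⟨(x, r x), hx, hr x⟩

/-- The gradient at `z` controls the distance of `z` to the saddle point. -/
theorem min_mul_le_enorm2_grad (h : SaddleClass f gx gy mx my Lx Lxy Ly) {zs : Pt n m}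
    (hx : gx zs.1 zs.2 = 0) (hy : gy zs.1 zs.2 = 0) (z : Pt n m) :
    min mx my * enorm2 (z - zs) ≤ enorm2 (gx z.1 z.2, gy z.1 z.2) := by
  have h1 := h.stronglyMonotone z.1 zs.1 z.2 zs.2
  rw [hx, hy, sub_zero, sub_zero] at h1
  have h2 := real_inner_le_norm (gx z.1 z.2) (z.1 - zs.1)
  have h3 := neg_le_of_abs_le (abs_real_inner_le_norm (gy z.1 z.2) (z.2 - zs.2))
  have e1 := enorm2_sq (z - zs)
  have e2 := enorm2_sq (gx z.1 z.2, gy z.1 z.2)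
  rw [Prod.fst_sub, Prod.snd_sub] at e1
  simp only at e2
  set D := enorm2 (z - zs)
  set N := enorm2 (gx z.1 z.2, gy z.1 z.2)
  have hD : 0 ≤ D := enorm2_nonneg _
  have hN : 0 ≤ N := enorm2_nonneg _
  have h4 : min mx my * D ^ 2 ≤ N * D := by
    have h5 : ‖gx z.1 z.2‖ * ‖z.1 - zs.1‖ + ‖gy z.1 z.2‖ * ‖z.2 - zs.2‖ ≤ N * D := by
      -- Cauchy–Schwarz in `ℝ²`, applied to the pairs of partial norms.
      refine abs_le_of_sq_le_sq' ?_ (by positivity) |>.2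
      rw [mul_pow, e1, e2]
      nlinarith [sq_nonneg (‖gx z.1 z.2‖ * ‖z.2 - zs.2‖ - ‖gy z.1 z.2‖ * ‖z.1 - zs.1‖)]
    have h6 : min mx my * ‖z.1 - zs.1‖ ^ 2 ≤ mx * ‖z.1 - zs.1‖ ^ 2 := by
      gcongr; exact min_le_left _ _
    have h7 : min mx my * ‖z.2 - zs.2‖ ^ 2 ≤ my * ‖z.2 - zs.2‖ ^ 2 := by
      gcongr; exact min_le_right _ _
    rw [e1]
    linarith
  rcases hD.eq_or_lt with h0 | h0
  · rw [← h0, mul_zero]; exact hN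
  · refine le_of_mul_le_mul_right ?_ h0
    linarith

theorem zero_unique (h : SaddleClass f gx gy mx my Lx Lxy Ly) (hmx : 0 < mx) (hmy : 0 < my)
    {z w : Pt n m} (hz : gx z.1 z.2 = 0 ∧ gy z.1 z.2 = 0) (hw : gx w.1 w.2 = 0 ∧ gy w.1 w.2 = 0) :
    z = w := by
  have h1 := h.stronglyMonotone z.1 w.1 z.2 w.2
  rw [hz.1, hz.2, hw.1, hw.2] at h1
  simp only [sub_zero, inner_zero_left] at h1
  have h2 : 0 ≤ mx * ‖z.1 - w.1‖ ^ 2 := by positivity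
  have h3 : 0 ≤ my * ‖z.2 - w.2‖ ^ 2 := by positivity
  have h4 : mx * ‖z.1 - w.1‖ ^ 2 = 0 := by linarith
  have h5 : my * ‖z.2 - w.2‖ ^ 2 = 0 := by linarith
  simp only [mul_eq_zero, hmx.ne', hmy.ne', false_or, ne_eq, OfNat.ofNat_ne_zero,
    not_false_eq_true, pow_eq_zero_iff, norm_eq_zero, sub_eq_zero] at h4 h5
  exact Prod.ext h4 h5

/-- The full gradient is `4L`-Lipschitz when `∇ₓ` is `3L`-Lipschitz in `x` and all other constants
are at most `L`. -/
theorem enorm2_grad_le (h : SaddleClass f gx gy mx my Lx Lxy Ly) {L : ℝ} (hL : 0 ≤ L)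
    (hLx : Lx ≤ 3 * L) (hLxy : Lxy ≤ L) (hLy : Ly ≤ L) {zs : Pt n m}
    (hx : gx zs.1 zs.2 = 0) (hy : gy zs.1 zs.2 = 0) (z : Pt n m) :
    enorm2 (gx z.1 z.2, gy z.1 z.2) ≤ 4 * L * enorm2 (z - zs) := by
  have h' := h.mono le_rfl le_rfl hLx hLxy hLy
  have h1 : ‖gx z.1 z.2‖ ≤ 3 * L * ‖z.1 - zs.1‖ + L * ‖z.2 - zs.2‖ := by
    have e : gx z.1 z.2 = (gx z.1 z.2 - gx zs.1 z.2) + (gx zs.1 z.2 - gx zs.1 zs.2) := by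
      rw [hx]; abel
    rw [e]
    exact (norm_add_le _ _).trans (add_le_add (h'.lip_xx _ _ _) (h'.lip_xy _ _ _))
  have h2 : ‖gy z.1 z.2‖ ≤ L * ‖z.1 - zs.1‖ + L * ‖z.2 - zs.2‖ := by
    have e : gy z.1 z.2 = (gy z.1 z.2 - gy zs.1 z.2) + (gy zs.1 z.2 - gy zs.1 zs.2) := by
      rw [hy]; abel
    rw [e]
    exact (norm_add_le _ _).trans (add_le_add (h'.lip_yx _ _ _) (h'.lip_yy _ _ _))
  refine enorm2_le_of_sq_le (by positivity) ?_
  rw [enorm2_sq, enorm2_sq, Prod.fst_sub, Prod.snd_sub]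
  have h3 := pow_le_pow_left₀ (norm_nonneg _) h1 2
  have h4 := pow_le_pow_left₀ (norm_nonneg _) h2 2
  nlinarith [mul_nonneg (sq_nonneg L) (sq_nonneg (‖z.1 - zs.1‖ - ‖z.2 - zs.2‖)),
    mul_nonneg (sq_nonneg L) (sq_nonneg ‖z.1 - zs.1‖),
    mul_nonneg (sq_nonneg L) (sq_nonneg ‖z.2 - zs.2‖)]

end SaddleClass

end Minimax
-- Alternating Best Response.
namespace Minimax

variable {n m : ℕ} {f : Vec n → Vec m → ℝ} {gx : Vec n → Vec m → Vec n}
  {gy : Vec n → Vec m → Vec m} {mx my Lx Lxy Ly : ℝ}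

/-- With norms weighted by the square roots of the moduli, weak coupling turns the Lipschitz bound
for a best response into contraction by `1/2`, in both directions at once. -/
theorem sqrt_mul_response_le {μ ν c A B : ℝ} (hμ : 0 < μ) (hν : 0 < ν)
    (hc : 4 * c ^ 2 ≤ μ * ν) (hB : 0 ≤ B) (h : μ * A ≤ c * B) :
    √μ * A ≤ 1 / 2 * (√ν * B) := by
  have h1 : c ≤ 1 / 2 * (√μ * √ν) := by
    refine abs_le_of_sq_le_sq' ?_ (by positivity) |>.2
    rw [mul_pow, mul_pow, Real.sq_sqrt hμ.le, Real.sq_sqrt hν.le]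
    linarith
  refine le_of_mul_le_mul_left ?_ (Real.sqrt_pos.2 hμ)
  calc √μ * (√μ * A) = μ * A := by rw [← mul_assoc, Real.mul_self_sqrt hμ.le]
    _ ≤ c * B := h
    _ ≤ 1 / 2 * (√μ * √ν) * B := by gcongr
    _ = _ := by ring

theorem abr_calls {O : Oracle n m} (hO : ∀ z, (O z).calls = 1) (z₀ : Pt n m)
    (ε μx μy lx ly : ℝ) : (abr O z₀ ε μx μy lx ly).calls =
      ⌈Real.logb 2 (4 * √(lx / μx + ly / μy) / ε)⌉₊ *
        (⌈2 * √(lx / μx) * Real.log (24 * (lx / μx))⌉₊ +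
          ⌈2 * √(ly / μy) * Real.log (24 * (ly / μy))⌉₊) := by
  rw [abr, forLoop_calls]
  intro s
  simp only [Counted.bind_calls, Counted.pure_calls, add_zero]
  rw [agd_calls (by intro x; simp [hO]), agd_calls (by intro x; simp [hO])]

/-- A round moves each player to within `1/16` of its old distance from its best response, and exact
responses contract by `1/2` in the weighted norms. A weighted sum of the two errors therefore halves
in each round. -/
theorem abr_contract (h : SaddleClass f gx gy mx my Lx Lxy Ly) {l : ℝ} (hmx : 0 < mx)
    (hmy : 0 < my) (hmxl : mx ≤ l) (hmyl : my ≤ l) (hLx : Lx ≤ l) (hLy : Ly ≤ l)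
    (hLxy : 4 * Lxy ^ 2 ≤ mx * my) {O : Oracle n m}
    (hO : ∀ z, (O z).val = (gx z.1 z.2, gy z.1 z.2)) {zs : Pt n m}
    (hxs : gx zs.1 zs.2 = 0) (hys : gy zs.1 zs.2 = 0) {ε : ℝ} (hε : 0 < ε) (z₀ : Pt n m) :
    enorm2 ((abr O z₀ ε mx my l l).val - zs) ≤ ε * enorm2 (z₀ - zs) := by
  have h' := h.mono le_rfl le_rfl hLx (le_refl Lxy) hLy
  obtain ⟨rx, hrx⟩ := h.exists_response_left hmx
  obtain ⟨ry, hry⟩ := h.exists_response hmy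
  -- Write `a`, `b` for the weighted errors. Exact responses give `a' ≤ b/2` and `b' ≤ a'/2`, hence
  -- `a' + 4b' ≤ 3b/2`, which is below half of `4b`. The weight `4` leaves room for the inexactness
  -- `1/16`.
  let Φ : Pt n m → ℝ := fun z => √mx * ‖z.1 - zs.1‖ + 4 * (√my * ‖z.2 - zs.2‖)
  have hx1 : ∀ x y, √mx * ‖x - rx y‖ ≤ √mx * ‖x - zs.1‖ + 1 / 2 * (√my * ‖y - zs.2‖) ∧
      √mx * ‖rx y - zs.1‖ ≤ 1 / 2 * (√my * ‖y - zs.2‖) := by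
    intro x y
    have h1 := sqrt_mul_response_le hmx hmy hLxy (norm_nonneg _)
      (h.response_left_lipschitz (hrx y) hxs)
    have h2 := norm_sub_le_norm_sub_add_norm_sub x zs.1 (rx y)
    rw [norm_sub_rev zs.1] at h2
    have h3 := mul_le_mul_of_nonneg_left h2 (Real.sqrt_nonneg mx)
    exact ⟨by linarith, h1⟩
  have hy1 : ∀ x y, √my * ‖y - ry x‖ ≤ √my * ‖y - zs.2‖ + 1 / 2 * (√mx * ‖x - zs.1‖) ∧
      √my * ‖ry x - zs.2‖ ≤ 1 / 2 * (√mx * ‖x - zs.1‖) := by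
    intro x y
    have h1 := sqrt_mul_response_le hmy hmx (by linarith) (norm_nonneg _)
      (h.response_lipschitz (hry x) hys)
    have h2 := norm_sub_le_norm_sub_add_norm_sub y zs.2 (ry x)
    rw [norm_sub_rev zs.2] at h2
    have h3 := mul_le_mul_of_nonneg_left h2 (Real.sqrt_nonneg my)
    exact ⟨by linarith, h1⟩
  set T := ⌈Real.logb 2 (4 * √(l / mx + l / my) / ε)⌉₊ with hT
  set w := (abr O z₀ ε mx my l l).val with hw
  have key : Φ w ≤ (1 / 2) ^ T * Φ z₀ := by
    refine forLoop_potential (Φ := Φ) (by norm_num) ?_ T z₀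
    intro ⟨x, y⟩
    simp only [Counted.bind_val, Counted.pure_val]
    have hax := agd_contract (h := fun x => f x y) (g := fun x => gx x y)
      (G := fun x => do let g ← O (x, y); pure g.1) (by intro x; simp [hO]) hmx hmxl
      (fun u v => h'.cvx u v y) (fun u v => h'.smx u v y) (hrx y) x
    set x' := (agd (fun x => do let g ← O (x, y); pure g.1) l mx
      ⌈2 * √(l / mx) * Real.log (24 * (l / mx))⌉₊ x).val
    have hay := agd_contract (h := fun y => -f x' y) (g := fun y => -gy x' y)
      (G := fun y => do let g ← O (x', y); pure (-g.2)) (by intro x; simp [hO]) hmy hmyl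
      (fun u v => h'.swap.cvx u v x') (fun u v => h'.swap.smx u v x')
      (neg_eq_zero.2 (hry x')) y
    set y' := (agd (fun y => do let g ← O (x', y); pure (-g.2)) l my
      ⌈2 * √(l / my) * Real.log (24 * (l / my))⌉₊ y).val
    simp only [Φ]
    obtain ⟨a1, a2⟩ := hx1 x y
    obtain ⟨b1, b2⟩ := hy1 x' y
    have hax' := mul_le_mul_of_nonneg_left hax (Real.sqrt_nonneg mx)
    have hay' := mul_le_mul_of_nonneg_left hay (Real.sqrt_nonneg my)
    have c1 := mul_le_mul_of_nonneg_left
      (norm_sub_le_norm_sub_add_norm_sub x' (rx y) zs.1) (Real.sqrt_nonneg mx)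
    have c2 := mul_le_mul_of_nonneg_left
      (norm_sub_le_norm_sub_add_norm_sub y' (ry x') zs.2) (Real.sqrt_nonneg my)
    have p1 : 0 ≤ √mx * ‖x - zs.1‖ := by positivity
    have p2 : 0 ≤ √my * ‖y - zs.2‖ := by positivity
    linarith
  have hl0 : 0 < l := hmx.trans_le hmxl
  set S := l / mx + l / my with hS
  have hS0 : 0 < S := by positivity
  have hpow : (1 / 2 : ℝ) ^ T ≤ ε / (4 * √S) := by
    have h1 : 4 * √S / ε ≤ 2 ^ T := by
      rw [← Real.rpow_natCast, ← Real.logb_le_iff_le_rpow one_lt_two (by positivity)]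
      exact Nat.le_ceil _
    rw [one_div, inv_pow, ← inv_div]
    exact inv_anti₀ (by positivity) h1
  have hΦ : Φ w ≤ ε / (4 * √S) * Φ z₀ :=
    key.trans (mul_le_mul_of_nonneg_right hpow (by simp only [Φ]; positivity))
  have hΦ2 : Φ w ^ 2 ≤ ε ^ 2 / (16 * S) * Φ z₀ ^ 2 := by
    have := pow_le_pow_left₀ (by simp only [Φ]; positivity) hΦ 2
    rwa [mul_pow, div_pow, mul_pow, Real.sq_sqrt hS0.le, show (4 : ℝ) ^ 2 = 16 by norm_num] at this
  have hlow : enorm2 (w - zs) ^ 2 ≤ (1 / mx + 1 / (16 * my)) * Φ w ^ 2 := by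
    rw [enorm2_sq, Prod.fst_sub, Prod.snd_sub, add_mul]
    have e1 : mx = √mx ^ 2 := (Real.sq_sqrt hmx.le).symm
    have e2 : my = √my ^ 2 := (Real.sq_sqrt hmy.le).symm
    refine add_le_add ?_ ?_
    · rw [one_div_mul_eq_div, le_div_iff₀ hmx]
      calc ‖w.1 - zs.1‖ ^ 2 * mx = (√mx * ‖w.1 - zs.1‖) ^ 2 := by
            rw [mul_pow, ← e1]; ring
        _ ≤ _ := by
          gcongr
          simp only [Φ]
          have : 0 ≤ √my * ‖w.2 - zs.2‖ := by positivity
          linarith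
    · rw [one_div_mul_eq_div, le_div_iff₀ (by positivity)]
      calc ‖w.2 - zs.2‖ ^ 2 * (16 * my) = (4 * (√my * ‖w.2 - zs.2‖)) ^ 2 := by
            rw [mul_pow, mul_pow, ← e2]; ring
        _ ≤ _ := by
          gcongr
          simp only [Φ]
          have : 0 ≤ √mx * ‖w.1 - zs.1‖ := by positivity
          linarith
  have hup : Φ z₀ ^ 2 ≤ (mx + 16 * my) * enorm2 (z₀ - zs) ^ 2 := by
    rw [enorm2_sq, Prod.fst_sub, Prod.snd_sub]
    simp only [Φ]
    have e1 : mx = √mx ^ 2 := (Real.sq_sqrt hmx.le).symm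
    have e2 : my = √my ^ 2 := (Real.sq_sqrt hmy.le).symm
    generalize ‖z₀.1 - zs.1‖ = A at *
    generalize ‖z₀.2 - zs.2‖ = B at *
    have e3 : (mx + 16 * my) * (A ^ 2 + B ^ 2)
        = (√mx ^ 2 + 16 * √my ^ 2) * (A ^ 2 + B ^ 2) := by rw [← e1, ← e2]
    rw [e3]
    linarith [sq_nonneg (√mx * B - 4 * √my * A)]
  -- Passing from the Euclidean norm to `Φ` and back costs at most `16 S` in squares. This is the
  -- square of the `4√S` inside the logarithm of the round count.
  have hconst : (1 / mx + 1 / (16 * my)) * (mx + 16 * my) ≤ 16 * S := by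
    have e : (1 / mx + 1 / (16 * my)) * (mx + 16 * my) = 2 + 16 * (my / mx) + mx / my / 16 := by
      field_simp; ring
    rw [e, hS]
    have h1 : my / mx ≤ l / mx := by gcongr
    have h2 : mx / my ≤ l / my := by gcongr
    have h3 : 1 ≤ l / my := by rwa [one_le_div hmy]
    linarith
  refine enorm2_le_of_sq_le hε.le ?_
  have hD := sq_nonneg (enorm2 (z₀ - zs))
  calc enorm2 (w - zs) ^ 2 ≤ (1 / mx + 1 / (16 * my)) * Φ w ^ 2 := hlow
    _ ≤ (1 / mx + 1 / (16 * my)) * (ε ^ 2 / (16 * S) *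
          ((mx + 16 * my) * enorm2 (z₀ - zs) ^ 2)) := by gcongr; exact hΦ2.trans (by gcongr)
    _ = (1 / mx + 1 / (16 * my)) * (mx + 16 * my) *
          (ε ^ 2 / (16 * S) * enorm2 (z₀ - zs) ^ 2) := by ring
    _ ≤ 16 * S * (ε ^ 2 / (16 * S) * enorm2 (z₀ - zs) ^ 2) := by gcongr
    _ = ε ^ 2 * enorm2 (z₀ - zs) ^ 2 := by field_simp

end Minimax
-- The inexact accelerated proximal point method, abstractly.
namespace Minimax

section ProximalPoint

variable {E F : Type*} [NormedAddCommGroup E] [InnerProductSpace ℝ E] [NormedAddCommGroup F]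

/-- The potential of the inexact accelerated proximal point method for `h`, with response map `r`:
`v` is the auxiliary sequence and `w` the approximation of the response `r y`. -/
noncomputable def proxPotential (h : E → ℝ) (r : E → F) (ys : E) (μ ρ : ℝ) (y v : E) (w : F) : ℝ :=
  h y - h ys + μ / 4 * ‖v - ys‖ ^ 2 + μ / ρ ^ 2 * ‖w - r y‖ ^ 2

variable {h : E → ℝ} {G : E → E} {r : E → F} {ys : E} {μ ρ Λ : ℝ}

theorem sub_min_ge (hcvx : ∀ u v, h u + inner ℝ (G u) (v - u) + μ / 2 * ‖v - u‖ ^ 2 ≤ h v)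
    (hys : G ys = 0) (y : E) : μ / 2 * ‖y - ys‖ ^ 2 ≤ h y - h ys := by
  have := hcvx ys y
  rw [hys, inner_zero_left] at this
  linarith

/-- Convexity at the other endpoint and Cauchy–Schwarz avoid both integration and any
differentiability of `h`, at the price of `Λ` in place of `Λ/2`. -/
theorem le_of_lipschitz (hμ : 0 ≤ μ)
    (hcvx : ∀ u v, h u + inner ℝ (G u) (v - u) + μ / 2 * ‖v - u‖ ^ 2 ≤ h v)
    (hlip : ∀ u v, ‖G u - G v‖ ≤ Λ * ‖u - v‖) (u v : E) :
    h v ≤ h u + inner ℝ (G u) (v - u) + Λ * ‖v - u‖ ^ 2 := by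
  have h1 := hcvx v u
  rw [← neg_sub v u, inner_neg_right, norm_neg] at h1
  have h2 := real_inner_le_norm (G v - G u) (v - u)
  rw [inner_sub_left] at h2
  have h3 := mul_le_mul_of_nonneg_right (hlip v u) (norm_nonneg (v - u))
  have h4 : 0 ≤ μ / 2 * ‖v - u‖ ^ 2 := by positivity
  linarith

omit [InnerProductSpace ℝ E] in
-- Replaces the response at the unknown point `q` by the response at `y`, which is what the
-- potential measures.
theorem response_dist_sq_le (hρ : 1 ≤ ρ) (hr : ∀ u v, ‖r u - r v‖ ≤ ρ * ‖u - v‖) (y q : E)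
    (w : F) : ‖w - r q‖ ^ 2 + ‖y - q‖ ^ 2 ≤ 2 * ‖w - r y‖ ^ 2 + 3 * ρ ^ 2 * ‖y - q‖ ^ 2 := by
  have h1 : ‖w - r q‖ ≤ ‖w - r y‖ + ρ * ‖y - q‖ :=
    (norm_sub_le_norm_sub_add_norm_sub w (r y) (r q)).trans (by gcongr; exact hr y q)
  have h2 := pow_le_pow_left₀ (norm_nonneg _) h1 2
  have h3 : 1 * ‖y - q‖ ^ 2 ≤ ρ ^ 2 * ‖y - q‖ ^ 2 := by gcongr; nlinarith
  nlinarith [sq_nonneg (‖w - r y‖ - ρ * ‖y - q‖)]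

theorem proxPotential_nonneg (hμ : 0 < μ)
    (hcvx : ∀ u v, h u + inner ℝ (G u) (v - u) + μ / 2 * ‖v - u‖ ^ 2 ≤ h v)
    (hys : G ys = 0) (y v : E) (w : F) : 0 ≤ proxPotential h r ys μ ρ y v w := by
  have h1 := sub_min_ge hcvx hys y
  have h2 : 0 ≤ μ / 2 * ‖y - ys‖ ^ 2 := by positivity
  have h3 : 0 ≤ h y - h ys := h2.trans h1
  unfold proxPotential
  positivity

/-- The potential controls the distance to the solution. -/
theorem dist_sq_le_proxPotential (hμ : 0 < μ) (hρ : 1 ≤ ρ)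
    (hcvx : ∀ u v, h u + inner ℝ (G u) (v - u) + μ / 2 * ‖v - u‖ ^ 2 ≤ h v)
    (hys : G ys = 0) (hr : ∀ u v, ‖r u - r v‖ ≤ ρ * ‖u - v‖) (y v : E) (w : F) :
    ‖w - r ys‖ ^ 2 + ‖y - ys‖ ^ 2 ≤ 6 * ρ ^ 2 / μ * proxPotential h r ys μ ρ y v w := by
  have h1 := sub_min_ge hcvx hys y
  have h2 := response_dist_sq_le hρ hr y ys w
  have h3 : 6 * ρ ^ 2 / μ * proxPotential h r ys μ ρ y v w
      = 6 * ρ ^ 2 / μ * (h y - h ys) + 6 * ρ ^ 2 / 4 * ‖v - ys‖ ^ 2 + 6 * ‖w - r y‖ ^ 2 := by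
    unfold proxPotential
    have : ρ ≠ 0 := by positivity
    field_simp
  have h4 := mul_le_mul_of_nonneg_left h1 (by positivity : 0 ≤ 6 * ρ ^ 2 / μ)
  have h5 : 6 * ρ ^ 2 / μ * (μ / 2 * ‖y - ys‖ ^ 2) = 3 * ρ ^ 2 * ‖y - ys‖ ^ 2 := by
    field_simp; ring
  have h6 : 0 ≤ 6 * ρ ^ 2 / 4 * ‖v - ys‖ ^ 2 := by positivity
  have h7 : 0 ≤ ‖w - r y‖ ^ 2 := by positivity
  linarith

/-- The potential at the start of the method. -/
theorem proxPotential_init_le (hμ : 0 < μ) (hρ : 1 ≤ ρ) (hΛ : 0 ≤ Λ)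
    (hcvx : ∀ u v, h u + inner ℝ (G u) (v - u) + μ / 2 * ‖v - u‖ ^ 2 ≤ h v)
    (hlip : ∀ u v, ‖G u - G v‖ ≤ Λ * ‖u - v‖)
    (hys : G ys = 0) (hr : ∀ u v, ‖r u - r v‖ ≤ ρ * ‖u - v‖) (y : E) (w : F) :
    proxPotential h r ys μ ρ y y w ≤ (Λ + 9 / 4 * μ) * (‖w - r ys‖ ^ 2 + ‖y - ys‖ ^ 2) := by
  have h1 := le_of_lipschitz hμ.le hcvx hlip ys y
  rw [hys, inner_zero_left] at h1
  have h2 : ‖w - r y‖ ≤ ‖w - r ys‖ + ρ * ‖y - ys‖ := by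
    refine (norm_sub_le_norm_sub_add_norm_sub w (r ys) (r y)).trans ?_
    rw [norm_sub_rev y]
    gcongr; exact hr _ _
  have h3 : ‖w - r y‖ ^ 2 ≤ 2 * ‖w - r ys‖ ^ 2 + 2 * ρ ^ 2 * ‖y - ys‖ ^ 2 := by
    have := pow_le_pow_left₀ (norm_nonneg _) h2 2
    nlinarith [sq_nonneg (‖w - r ys‖ - ρ * ‖y - ys‖)]
  have h4 : μ / ρ ^ 2 * ‖w - r y‖ ^ 2 ≤ 2 * μ * ‖w - r ys‖ ^ 2 + 2 * μ * ‖y - ys‖ ^ 2 := by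
    have hρ0 : 0 < ρ := by positivity
    calc μ / ρ ^ 2 * ‖w - r y‖ ^ 2
        ≤ μ / ρ ^ 2 * (2 * ‖w - r ys‖ ^ 2 + 2 * ρ ^ 2 * ‖y - ys‖ ^ 2) := by gcongr
      _ = 2 * (μ / ρ ^ 2) * ‖w - r ys‖ ^ 2 + 2 * μ * ‖y - ys‖ ^ 2 := by field_simp
      _ ≤ _ := by
        gcongr
        exact div_le_self hμ.le (one_le_pow₀ hρ)
  unfold proxPotential
  have h5 : 0 ≤ (Λ + 1 / 4 * μ) * ‖w - r ys‖ ^ 2 := by positivity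
  linarith

set_option maxHeartbeats 1000000 in
/-- One step of the inexact accelerated proximal point method contracts the potential, provided the
proximal problem is solved up to the relative accuracy `δ`. -/
theorem proxPotential_step {β α δ : ℝ} (hμ : 0 < μ) (hρ : 1 ≤ ρ) (hμβ : μ ≤ β) (hΛ : 0 ≤ Λ)
    (hα : 0 < α) (hαβ : 4 * α ^ 2 * β = μ) (hδ : 0 ≤ δ) (hδ1 : ρ * δ ≤ α ^ 2 / 20)
    (hδ2 : Λ * (ρ * δ) ^ 2 ≤ μ * α / 1600)
    (hcvx : ∀ u v, h u + inner ℝ (G u) (v - u) + μ / 2 * ‖v - u‖ ^ 2 ≤ h v)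
    (hlip : ∀ u v, ‖G u - G v‖ ≤ Λ * ‖u - v‖)
    (hys : G ys = 0) (hr : ∀ u v, ‖r u - r v‖ ≤ ρ * ‖u - v‖)
    {y v p q y' : E} {w w' : F} (hp : (1 + α) • p = y + α • v)
    (hq : G q = (2 * β) • (p - q))
    (herr : ‖w' - r q‖ ^ 2 + ‖y' - q‖ ^ 2 ≤ δ ^ 2 * (‖w - r q‖ ^ 2 + ‖y - q‖ ^ 2)) :
    proxPotential h r ys μ ρ y' ((1 - α) • v + α • y' + α⁻¹ • (y' - p)) w' ≤
      (1 - α / 2) * proxPotential h r ys μ ρ y v w := by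
  have hβ : 0 < β := hμ.trans_le hμβ
  have hρ0 : 0 < ρ := by positivity
  have hα2 : α ≤ 1 / 2 := by
    have h1 : 4 * α ^ 2 * β ≤ 1 * β := by linarith
    have h2 := le_of_mul_le_mul_right h1 hβ
    refine abs_le_of_sq_le_sq' ?_ (by norm_num) |>.2
    linarith
  have hαsq : α ^ 2 ≤ 1 / 4 := by
    calc α ^ 2 ≤ (1 / 2) ^ 2 := by gcongr
      _ = 1 / 4 := by norm_num
  set P := proxPotential h r ys μ ρ y v w with hP
  have hP0 : 0 ≤ P := proxPotential_nonneg hμ hcvx hys y v w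
  set B := h y - h ys + μ / 4 * ‖v - ys‖ ^ 2 with hB
  have hBP : B ≤ P := by
    have : 0 ≤ μ / ρ ^ 2 * ‖w - r y‖ ^ 2 := by positivity
    rw [hP, proxPotential]; linarith
  -- the exact step
  set ve := (1 - α) • v + α • q - (α / (μ / 2)) • G q with hve
  have hexact : h q - h ys + μ / 4 * ‖ve - ys‖ ^ 2 ≤ (1 - α) * B - 1 / (8 * β) * ‖G q‖ ^ 2 := by
    have h1 : h q + inner ℝ (G q) (y - q) ≤ h y := by
      have := hcvx q y
      have h' : 0 ≤ μ / 2 * ‖y - q‖ ^ 2 := by positivity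
      linarith
    have h2 : h q + inner ℝ (G q) (ys - q) + μ / 2 / 2 * ‖ys - q‖ ^ 2 ≤ h ys := by
      have := hcvx q ys
      have h' : 0 ≤ μ / 4 * ‖ys - q‖ ^ 2 := by positivity
      linarith
    -- Only the modulus `μ/2` is used. With the proximal step `1/(2β)` this makes `α² = (μ/2)/(2β)`,
    -- and a negative multiple of `‖G q‖²` is left over to absorb the error in the function value.
    have hest := estimate_step (v := v) (α := α) (by positivity) hα.le (by linarith) h1 h2
    have e1 : y + α • v - (1 + α) • q = ((1 + α) / (2 * β)) • G q := by
      rw [← hp, hq, ← smul_sub, smul_smul]; congr 1; field_simp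
    rw [e1, real_inner_smul_right, real_inner_self_eq_norm_sq, ← hve] at hest
    have e2 : α ^ 2 / (2 * (μ / 2)) = 1 / (4 * β) := by
      rw [← hαβ]; field_simp
    rw [e2] at hest
    have e3 : (1 - α) * ((1 + α) / (2 * β) * ‖G q‖ ^ 2)
        = (1 - α ^ 2) * 4 * (1 / (8 * β) * ‖G q‖ ^ 2) := by field_simp; ring
    have e4 : 1 / (4 * β) * ‖G q‖ ^ 2 = 2 * (1 / (8 * β) * ‖G q‖ ^ 2) := by field_simp; ring
    have e5 : 0 ≤ (1 / (8 * β) * ‖G q‖ ^ 2) := by positivity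
    rw [e3, e4] at hest
    have e6 : 3 * (1 / (8 * β) * ‖G q‖ ^ 2) ≤ (1 - α ^ 2) * 4 * (1 / (8 * β) * ‖G q‖ ^ 2) := by
      gcongr; linarith
    have e7 : μ / 2 / 2 = μ / 4 := by ring
    rw [e7, ← hB] at hest
    linarith
  have hG0 : 0 ≤ 1 / (8 * β) * ‖G q‖ ^ 2 := by positivity
  have hB0 : 0 ≤ B := by
    have h1 := sub_min_ge hcvx hys y
    have h2 : 0 ≤ μ / 2 * ‖y - ys‖ ^ 2 := by positivity
    have h3 : 0 ≤ μ / 4 * ‖v - ys‖ ^ 2 := by positivity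
    linarith
  have hqB : h q - h ys ≤ B := by
    have h3 : 0 ≤ μ / 4 * ‖ve - ys‖ ^ 2 := by positivity
    have h4 := mul_nonneg hα.le hB0
    linarith
  have hveB : μ / 4 * ‖ve - ys‖ ^ 2 ≤ P := by
    have h1 := sub_min_ge hcvx hys q
    have h2 : 0 ≤ μ / 2 * ‖q - ys‖ ^ 2 := by positivity
    have h4 := mul_nonneg hα.le hB0
    linarith
  -- the size of the proximal displacement
  set D2 := ‖w - r q‖ ^ 2 + ‖y - q‖ ^ 2 with hD2
  -- Both `y` and `q` have envelope gap at most `B`, so the warm start is already within a multiple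
  -- of the potential of the subproblem's solution. This is why a relative accuracy suffices.
  have hD2P : μ * D2 ≤ 24 * ρ ^ 2 * P := by
    have h1 := response_dist_sq_le hρ hr y q w
    have h2 := sub_min_ge hcvx hys q
    have h3 := sub_min_ge hcvx hys y
    have h4 : ‖y - q‖ ^ 2 ≤ 2 * ‖y - ys‖ ^ 2 + 2 * ‖q - ys‖ ^ 2 := by
      have := norm_sub_le_norm_sub_add_norm_sub y ys q
      rw [norm_sub_rev ys] at this
      have h5 := pow_le_pow_left₀ (norm_nonneg _) this 2
      have h6 := add_sq_le (a := ‖y - ys‖) (b := ‖q - ys‖)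
      linarith
    have h5 : h y - h ys ≤ B := by
      have h3 : 0 ≤ μ / 4 * ‖v - ys‖ ^ 2 := by positivity
      linarith
    have h6 : μ * ‖y - q‖ ^ 2 ≤ 8 * B := by
      have := mul_le_mul_of_nonneg_left h4 hμ.le
      linarith
    have h7 := mul_le_mul_of_nonneg_left h1 hμ.le
    have h8 := mul_le_mul_of_nonneg_left h6 (by positivity : 0 ≤ 3 * ρ ^ 2)
    have h9 : ρ ^ 2 * P = ρ ^ 2 * B + μ * ‖w - r y‖ ^ 2 := by
      rw [hP, hB, proxPotential]; field_simp
    have h10 : 0 ≤ μ * ‖w - r y‖ ^ 2 := by positivity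
    linarith
  have hD0 : 0 ≤ D2 := by positivity
  have hs : δ ^ 2 * (μ * D2) ≤ 24 * (ρ * δ) ^ 2 * P := by
    calc δ ^ 2 * (μ * D2) ≤ δ ^ 2 * (24 * ρ ^ 2 * P) := by gcongr
      _ = _ := by ring
  have hs1 : (ρ * δ) ^ 2 ≤ α ^ 4 / 400 := by
    have := pow_le_pow_left₀ (by positivity) hδ1 2
    calc _ ≤ _ := this
      _ = _ := by ring
  have hs2 : δ ^ 2 * (μ * D2) ≤ 3 / 50 * α ^ 4 * P := by
    refine hs.trans ?_
    have := mul_le_mul_of_nonneg_right hs1 hP0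
    linarith
  set e := y' - q with he
  have hye : ‖e‖ ^ 2 ≤ δ ^ 2 * D2 := by
    have : 0 ≤ ‖w' - r q‖ ^ 2 := by positivity
    linarith
  have hee : μ * ‖e‖ ^ 2 ≤ 3 / 50 * α ^ 4 * P := by
    have := mul_le_mul_of_nonneg_left hye hμ.le
    linarith
  -- the function value
  have hval : h y' - h ys ≤ h q - h ys + 1 / (8 * β) * ‖G q‖ ^ 2 + 3 / 100 * α * P := by
    have h1 := le_of_lipschitz hμ.le hcvx hlip q y'
    rw [← he] at h1
    -- Young's inequality, weighted so that the `‖G q‖²` term is the one left over from the exact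
    -- step.
    have h2 : inner ℝ (G q) e ≤ 1 / (8 * β) * ‖G q‖ ^ 2 + 2 * β * ‖e‖ ^ 2 := by
      have h3 := real_inner_le_norm (G q) e
      have h4 : 1 / (8 * β) * ‖G q‖ ^ 2 + 2 * β * ‖e‖ ^ 2 - ‖G q‖ * ‖e‖
          = 1 / (8 * β) * (‖G q‖ - 4 * β * ‖e‖) ^ 2 := by field_simp; ring
      have h5 : 0 ≤ 1 / (8 * β) * (‖G q‖ - 4 * β * ‖e‖) ^ 2 := by positivity
      linarith
    have h3 : 2 * β * ‖e‖ ^ 2 ≤ 15 / 1000 * α * P := by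
      have h4 : 4 * α ^ 2 * (β * ‖e‖ ^ 2) ≤ 4 * α ^ 2 * (3 / 200 * α ^ 2 * P) := by
        calc 4 * α ^ 2 * (β * ‖e‖ ^ 2) = μ * ‖e‖ ^ 2 := by rw [← hαβ]; ring
          _ ≤ _ := hee
          _ = _ := by ring
      have h5 := le_of_mul_le_mul_left h4 (by positivity)
      have h6 : α ^ 2 * P ≤ α * P / 2 := by
        have h7 := mul_le_mul_of_nonneg_right hα2 (mul_nonneg hα.le hP0)
        linarith
      linarith
    have h4 : Λ * ‖e‖ ^ 2 ≤ 15 / 1000 * α * P := by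
      refine le_of_mul_le_mul_left ?_ hμ
      calc μ * (Λ * ‖e‖ ^ 2) ≤ μ * (Λ * (δ ^ 2 * D2)) := by gcongr
        _ = Λ * (δ ^ 2 * (μ * D2)) := by ring
        _ ≤ Λ * (24 * (ρ * δ) ^ 2 * P) := by gcongr
        _ = 24 * (Λ * (ρ * δ) ^ 2) * P := by ring
        _ ≤ 24 * (μ * α / 1600) * P := by gcongr
        _ = _ := by ring
    linarith
  -- the auxiliary point
  have hv' : (1 - α) • v + α • y' + α⁻¹ • (y' - p) = ve + (α + α⁻¹) • e := by
    have h1 : α / (μ / 2) * (2 * β) = α⁻¹ := by rw [← hαβ]; field_simp; norm_num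
    rw [hve, hq, smul_smul, h1, he]
    module
  have haux : μ / 4 * ‖ve + (α + α⁻¹) • e - ys‖ ^ 2
      ≤ μ / 4 * ‖ve - ys‖ ^ 2 + α / 4 * P + 12 / 100 * α * P := by
    have e1 : ve + (α + α⁻¹) • e - ys = (ve - ys) + (α + α⁻¹) • e := by abel
    have h1 : ‖ve + (α + α⁻¹) • e - ys‖ ≤ ‖ve - ys‖ + (α + α⁻¹) * ‖e‖ := by
      rw [e1]
      refine (norm_add_le _ _).trans ?_
      rw [norm_smul, Real.norm_of_nonneg (by positivity)]
    have hγ : α + α⁻¹ ≤ 5 / 4 * α⁻¹ := by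
      have : α * α ≤ 1 / 4 := by rw [← sq]; exact hαsq
      have h3 : α ≤ 1 / 4 * α⁻¹ := by
        rw [← div_eq_mul_inv, le_div_iff₀ hα]; exact this
      linarith
    have h2 : ‖ve + (α + α⁻¹) • e - ys‖ ≤ ‖ve - ys‖ + 5 / 4 * α⁻¹ * ‖e‖ :=
      h1.trans (by gcongr)
    have h3 := pow_le_pow_left₀ (norm_nonneg _) h2 2
    set a := ‖ve - ys‖
    set b := ‖e‖
    -- The error reaches the auxiliary point magnified by about `α⁻¹`, and Young's inequality with
    -- weight `α/4` costs another `α⁻¹`. Hence `μ α⁻³ ‖e‖²` must be of order `α` times the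
    -- potential, which is why `ρ δ` is required to be of order `α²`.
    have h4 : (a + 5 / 4 * α⁻¹ * b) ^ 2 ≤ (1 + α / 4) * a ^ 2
        + (1 + 4 / α) * (25 / 16 * (α⁻¹ ^ 2 * b ^ 2)) := by
      have h5 : 0 ≤ α / 4 * (a - 4 / α * (5 / 4 * α⁻¹ * b)) ^ 2 := by positivity
      have h6 : α / 4 * (a - 4 / α * (5 / 4 * α⁻¹ * b)) ^ 2 = α / 4 * a ^ 2
        + 4 / α * (25 / 16 * (α⁻¹ ^ 2 * b ^ 2)) - 2 * a * (5 / 4 * α⁻¹ * b) := by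
        field_simp; ring
      linarith
    have h5 : 1 + 4 / α ≤ 9 / 2 / α := by
      rw [le_div_iff₀ hα, add_mul, div_mul_cancel₀ _ hα.ne']; linarith
    have h6 : μ / 4 * ((1 + 4 / α) * (25 / 16 * (α⁻¹ ^ 2 * b ^ 2))) ≤ 12 / 100 * α * P := by
      calc μ / 4 * ((1 + 4 / α) * (25 / 16 * (α⁻¹ ^ 2 * b ^ 2)))
          ≤ μ / 4 * (9 / 2 / α * (25 / 16 * (α⁻¹ ^ 2 * b ^ 2))) := by gcongr
        _ = 225 / 128 * (α⁻¹ ^ 3) * (μ * b ^ 2) := by field_simp; ring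
        _ ≤ 225 / 128 * (α⁻¹ ^ 3) * (3 / 50 * α ^ 4 * P) := by gcongr
        _ = 27 / 256 * α * P := by field_simp; ring
        _ ≤ _ := by linarith [mul_nonneg hα.le hP0]
    have h7 := mul_le_mul_of_nonneg_left (h3.trans h4) (by positivity : 0 ≤ μ / 4)
    have h8 := mul_le_mul_of_nonneg_left hveB (by positivity : 0 ≤ α / 4)
    linarith
  -- the response
  have hresp : μ / ρ ^ 2 * ‖w' - r y'‖ ^ 2 ≤ 2 / 100 * α * P := by
    have h1 : ‖w' - r y'‖ ≤ ‖w' - r q‖ + ρ * ‖e‖ := by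
      refine (norm_sub_le_norm_sub_add_norm_sub w' (r q) (r y')).trans ?_
      rw [he, norm_sub_rev y']
      gcongr; exact hr _ _
    -- The response map magnifies the error by at most `ρ`; the weight `μ/ρ²` in the potential
    -- cancels this.
    have h2 : ‖w' - r y'‖ ^ 2 ≤ 2 * ρ ^ 2 * (‖w' - r q‖ ^ 2 + ‖e‖ ^ 2) := by
      have h3 := pow_le_pow_left₀ (norm_nonneg _) h1 2
      have h4 : 1 * ‖w' - r q‖ ^ 2 ≤ ρ ^ 2 * ‖w' - r q‖ ^ 2 := by gcongr; exact one_le_pow₀ hρ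
      have h5 := add_sq_le (a := ‖w' - r q‖) (b := ρ * ‖e‖)
      linarith
    calc μ / ρ ^ 2 * ‖w' - r y'‖ ^ 2
        ≤ μ / ρ ^ 2 * (2 * ρ ^ 2 * (δ ^ 2 * D2)) := by
          gcongr
          exact h2.trans (by gcongr)
      _ = 2 * (δ ^ 2 * (μ * D2)) := by field_simp
      _ ≤ 2 * (3 / 50 * α ^ 4 * P) := by gcongr
      _ = 12 / 100 * α * P * α ^ 3 := by ring
      _ ≤ 12 / 100 * α * P * (1 / 2) ^ 3 := by gcongr
      _ ≤ _ := by
        have := mul_nonneg hα.le hP0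
        linarith
  rw [hv', proxPotential]
  -- The losses are `3/100`, `1/4`, `12/100` and `2/100` times `α P`, in total less than `α P / 2`.
  have hfin : (1 - α) * B ≤ (1 - α) * P := by gcongr; linarith
  have := mul_nonneg hα.le hP0
  linarith

end ProximalPoint

end Minimax
-- The proximal point method for saddle problems, and loops with a stopping test.
namespace Minimax

/-- The rate `1 / (2√κ)` of the accelerated proximal point method. -/
noncomputable def proxRate (κ : ℝ) : ℝ := 1 / (2 * √κ)

theorem proxRate_pos {κ : ℝ} (hκ : 0 < κ) : 0 < proxRate κ := by
  unfold proxRate; positivity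

theorem proxRate_sq {κ : ℝ} (hκ : 0 < κ) : proxRate κ ^ 2 = 1 / (4 * κ) := by
  rw [proxRate, div_pow, mul_pow, Real.sq_sqrt hκ.le]; norm_num

/-- The auxiliary point of the accelerated proximal point method. -/
noncomputable def auxPoint {d : ℕ} (κ : ℝ) (u uhat : Vec d) : Vec d :=
  (proxRate κ)⁻¹ • ((1 + proxRate κ) • uhat - u)

theorem auxPoint_self {d : ℕ} {κ : ℝ} (hκ : 0 < κ) (u : Vec d) : auxPoint κ u u = u := by
  have := (proxRate_pos hκ).ne'
  unfold auxPoint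
  match_scalars
  field_simp
  ring

theorem smul_eq_add_auxPoint {d : ℕ} {κ : ℝ} (hκ : 0 < κ) (u uhat : Vec d) :
    (1 + proxRate κ) • uhat = u + proxRate κ • auxPoint κ u uhat := by
  rw [auxPoint, smul_inv_smul₀ (proxRate_pos hκ).ne']
  abel

/-- In terms of `α = proxRate κ`, one has `θ = (1 - α)/(1 + α)` and `τ = α²/(1 + α)`. These are the
coefficients for which the extrapolated point encodes the recursion of the auxiliary sequence in
`proxPotential_step`. -/
theorem auxPoint_extrapolate {d : ℕ} {κ : ℝ} (hκ : 0 < κ) (u uhat u' : Vec d) :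
    auxPoint κ u' (extrapolate κ u uhat u') = (1 - proxRate κ) • auxPoint κ u uhat
      + proxRate κ • u' + (proxRate κ)⁻¹ • (u' - uhat) := by
  have hα := proxRate_pos hκ
  have hs : 0 < √κ := Real.sqrt_pos.2 hκ
  have h1 : theta κ = (1 - proxRate κ) / (1 + proxRate κ) := by
    rw [theta, proxRate]; field_simp
  have h2 : tau κ = proxRate κ ^ 2 / (1 + proxRate κ) := by
    rw [tau, proxRate]
    have e : 4 * κ = 4 * √κ ^ 2 := by rw [Real.sq_sqrt hκ.le]
    rw [e]; field_simp
    ring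
  rw [auxPoint, auxPoint, extrapolate, h1, h2]
  match_scalars <;> field_simp <;> ring

theorem enorm2_swap {n m : ℕ} (z : Pt n m) : enorm2 z.swap = enorm2 z := by
  rw [← sq_eq_sq₀ (enorm2_nonneg _) (enorm2_nonneg _), enorm2_sq, enorm2_sq, Prod.fst_swap,
    Prod.snd_swap, add_comm]

variable {n m : ℕ} {f : Vec n → Vec m → ℝ} {gx : Vec n → Vec m → Vec n}
  {gy : Vec n → Vec m → Vec m} {mx my Lx Lxy Ly : ℝ}

/-- The inexact accelerated proximal point method in `x` has a potential that contracts by the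
factor `1 - 1 / (4√κ)` in each iteration. -/
theorem SaddleClass.exists_potential (h : SaddleClass f gx gy mx my Lx Lxy Ly) (hmx : 0 < mx)
    (hmy : 0 < my) (hLxy : 0 ≤ Lxy) {β ρ Λ δ : ℝ} (hβ : mx ≤ β) (hρ : 1 ≤ ρ)
    (hρ' : Lxy ≤ ρ * my) (hΛ : 0 ≤ Λ) (hΛ' : Lx + Lxy * ρ ≤ Λ) (hδ : 0 ≤ δ)
    (hδ1 : ρ * δ ≤ proxRate (β / mx) ^ 2 / 20)
    (hδ2 : Λ * (ρ * δ) ^ 2 ≤ mx * proxRate (β / mx) / 1600)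
    {zs : Pt n m} (hxs : gx zs.1 zs.2 = 0) (hys : gy zs.1 zs.2 = 0) :
    ∃ Φ : Pt n m → Vec n → ℝ,
      (∀ z xhat, enorm2 (z - zs) ^ 2 ≤ 6 * ρ ^ 2 / mx * Φ z xhat) ∧
      (∀ z, Φ z z.1 ≤ (Λ + 9 / 4 * mx) * enorm2 (z - zs) ^ 2) ∧
      ∀ z xhat z', (∀ q : Pt n m, gx q.1 q.2 + (2 * β) • (q.1 - xhat) = 0 → gy q.1 q.2 = 0 →
          enorm2 (z' - q) ≤ δ * enorm2 (z - q)) →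
        Φ z' (extrapolate (β / mx) z.1 xhat z'.1) ≤ (1 - proxRate (β / mx) / 2) * Φ z xhat := by
  obtain ⟨r, hr⟩ := h.exists_response hmy
  have hβ0 : 0 < β := hmx.trans_le hβ
  have hκ : 0 < β / mx := by positivity
  have huniq : ∀ x y, gy x y = 0 → y = r x := by
    intro x y hy
    have := h.response_lipschitz hy (hr x)
    rw [sub_self x, norm_zero, mul_zero] at this
    have h2 : ‖y - r x‖ ≤ 0 := by
      by_contra! hc
      have := mul_pos hmy hc
      linarith
    exact sub_eq_zero.1 (norm_le_zero_iff.1 h2)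
  have hys' : zs.2 = r zs.1 := huniq _ _ hys
  have hG0 : gx zs.1 (r zs.1) = 0 := by rw [← hys']; exact hxs
  have hlip : ∀ x x', ‖r x - r x'‖ ≤ ρ * ‖x - x'‖ := by
    intro x x'
    refine le_of_mul_le_mul_left ?_ hmy
    calc my * ‖r x - r x'‖ ≤ Lxy * ‖x - x'‖ := h.response_lipschitz (hr x) (hr x')
      _ ≤ ρ * my * ‖x - x'‖ := by gcongr
      _ = _ := by ring
  have hcvx := h.envelope_cvx hmy.le hr
  have hGlip : ∀ x x', ‖gx x (r x) - gx x' (r x')‖ ≤ Λ * ‖x - x'‖ := fun x x' =>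
    (h.envelope_lipschitz hLxy hlip x x').trans (by gcongr)
  -- The second component `z.2` plays the approximate response, and the auxiliary point is read off
  -- from `z.1` and `xhat`, so the potential depends on the loop state alone.
  refine ⟨fun z xhat => proxPotential (fun x => f x (r x)) r zs.1 mx ρ z.1
    (auxPoint (β / mx) z.1 xhat) z.2, ?_, ?_, ?_⟩
  · intro z xhat
    have := dist_sq_le_proxPotential (h := fun x => f x (r x)) (G := fun x => gx x (r x))
      hmx hρ hcvx hG0 hlip z.1 (auxPoint (β / mx) z.1 xhat) z.2
    rw [enorm2_sq, Prod.fst_sub, Prod.snd_sub, hys']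
    linarith
  · intro z
    have := proxPotential_init_le (h := fun x => f x (r x)) (G := fun x => gx x (r x))
      hmx hρ hΛ hcvx hGlip hG0 hlip z.1 z.2
    simp only [auxPoint_self hκ]
    rw [enorm2_sq, Prod.fst_sub, Prod.snd_sub, hys', add_comm (‖z.1 - zs.1‖ ^ 2)]
    exact this
  · intro z xhat z' hz'
    -- The saddle point of the regularized function: its first component is the exact proximal point
    -- of the envelope, its second the response there.
    obtain ⟨q, hqx, hqy⟩ := (h.proxX hβ0.le xhat).exists_zero (by positivity) hmy hLxy
    have hq := hz' q hqx hqy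
    have hq2 := huniq _ _ hqy
    have herr : ‖z'.2 - r q.1‖ ^ 2 + ‖z'.1 - q.1‖ ^ 2
        ≤ δ ^ 2 * (‖z.2 - r q.1‖ ^ 2 + ‖z.1 - q.1‖ ^ 2) := by
      have := pow_le_pow_left₀ (enorm2_nonneg _) hq 2
      rw [mul_pow, enorm2_sq, enorm2_sq, Prod.fst_sub, Prod.snd_sub, Prod.fst_sub, Prod.snd_sub,
        hq2] at this
      linarith
    have hqG : gx q.1 (r q.1) = (2 * β) • (xhat - q.1) := by
      rw [← hq2, eq_neg_of_add_eq_zero_left hqx, ← smul_neg, neg_sub]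
    have hα2 : 4 * proxRate (β / mx) ^ 2 * β = mx := by
      rw [proxRate_sq hκ]; field_simp
    have := proxPotential_step (h := fun x => f x (r x)) (G := fun x => gx x (r x)) hmx hρ hβ hΛ
      (proxRate_pos hκ) hα2 hδ hδ1 hδ2 hcvx hGlip hG0 hlip
      (smul_eq_add_auxPoint hκ z.1 xhat) hqG herr
    simp only [auxPoint_extrapolate hκ]
    exact this

/-- It is enough that the test holds at one iterate of the unguarded body: the loop stops there or
earlier, and the test holds wherever it stops. The index is `k + 1` because the body runs before the
first test. -/
theorem RepeatUntil.exists_of_iterate {σ : Type} {body : σ → Counted σ} {done : σ → Counted Prop}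
    {c d : ℕ} (hc : ∀ s, (body s).calls = c) (hd : ∀ s, (done s).calls = d) (k : ℕ) (s : σ)
    (hk : (done ((fun s => (body s).val)^[k + 1] s)).val) :
    ∃ q, RepeatUntil body done s q ∧ (done q.val).val ∧ q.calls ≤ (k + 1) * (c + d) := by
  induction k generalizing s with
  | zero => exact ⟨_, .last s hk, hk, by simp [hc, hd]⟩
  | succ k ih =>
    by_cases h1 : (done (body s).val).val
    · refine ⟨_, .last s h1, h1, ?_⟩
      simp only [hc, hd]
      exact Nat.le_mul_of_pos_left _ (by omega)
    · obtain ⟨q, hq, hq', hqc⟩ := ih (body s).val (by rwa [Function.iterate_succ_apply] at hk)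
      refine ⟨_, .again s q h1 hq, hq', ?_⟩
      simp only [hc, hd]
      linarith

theorem one_sub_pow_le_inv {a B : ℝ} (ha1 : a ≤ 1) (hB : 0 < B) {k : ℕ}
    (hk : Real.log B ≤ a * k) : (1 - a) ^ k ≤ B⁻¹ := by
  calc (1 - a) ^ k ≤ (Real.exp (-a)) ^ k := by
        refine pow_le_pow_left₀ (by linarith) ?_ k
        have := Real.add_one_le_exp (-a); linarith
    _ = Real.exp (-(a * k)) := by rw [← Real.exp_nat_mul]; ring_nf
    _ ≤ Real.exp (-Real.log B) := by gcongr
    _ = B⁻¹ := by rw [Real.exp_neg, Real.exp_log hB]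

end Minimax
-- The constants, and the accuracies that `M₁` and `M₂` provide.
namespace Minimax

/-- Consistency conditions on the constants, which hold for every nonempty class `𝓕`. -/
structure Params.Valid (p : Params) : Prop where
  mx_pos : 0 < p.mx
  my_pos : 0 < p.my
  mx_le : p.mx ≤ p.L
  my_le : p.my ≤ p.L
  Lxy_nonneg : 0 ≤ p.Lxy

/-- The condition number `L² / (mₓ m_y)`. -/
noncomputable def Params.cond (p : Params) : ℝ := p.L ^ 2 / (p.mx * p.my)

/-- `max {1, ln (L² / (mₓ m_y))}`. -/
noncomputable def Params.logCond (p : Params) : ℝ := max 1 (Real.log p.cond)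

namespace Params.Valid

variable {p : Params} (hp : p.Valid)

include hp

theorem L_pos : 0 < p.L := hp.mx_pos.trans_le hp.mx_le

omit hp in
theorem Lxy_le : p.Lxy ≤ p.L := (le_max_left _ _).trans (le_max_right _ _)

theorem β₁_le : p.β₁ ≤ p.L := max_le hp.mx_le Lxy_le

theorem β₂_le : p.β₂ ≤ p.L := max_le hp.my_le Lxy_le

theorem β₁_pos : 0 < p.β₁ := lt_max_of_lt_left hp.mx_pos

theorem β₂_pos : 0 < p.β₂ := lt_max_of_lt_left hp.my_pos

theorem M₁_pos : 0 < p.M₁ := by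
  have := hp.L_pos; have := hp.mx_pos; have := hp.my_pos
  unfold Params.M₁; positivity

theorem M₂_pos : 0 < p.M₂ := by
  have := hp.L_pos; have := hp.mx_pos; have := hp.my_pos
  unfold Params.M₂; positivity

/-- Squaring clears the half-integer exponents; the quantitative comparisons with `M₁` and `M₂` go
through their squares. -/
theorem M₁_sq : p.M₁ ^ 2 = 6400 * p.cond ^ 3 := by
  have h1 : (p.mx ^ (3 / 2 : ℝ)) ^ 2 = p.mx ^ 3 := by
    rw [← Real.rpow_natCast, ← Real.rpow_mul hp.mx_pos.le, ← Real.rpow_natCast]; norm_num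
  have h2 : (p.my ^ (3 / 2 : ℝ)) ^ 2 = p.my ^ 3 := by
    rw [← Real.rpow_natCast, ← Real.rpow_mul hp.my_pos.le, ← Real.rpow_natCast]; norm_num
  rw [Params.M₁, div_pow, mul_pow, mul_pow, h1, h2, Params.cond, div_pow, mul_pow]
  ring

theorem M₂_sq : p.M₂ ^ 2 = 9216 * (p.cond ^ 2 * (p.L / p.my)) := by
  have h1 : (p.L ^ (5 / 2 : ℝ)) ^ 2 = p.L ^ 5 := by
    rw [← Real.rpow_natCast, ← Real.rpow_mul hp.L_pos.le, ← Real.rpow_natCast]; norm_num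
  have h2 : (p.my ^ (3 / 2 : ℝ)) ^ 2 = p.my ^ 3 := by
    rw [← Real.rpow_natCast, ← Real.rpow_mul hp.my_pos.le, ← Real.rpow_natCast]; norm_num
  have := hp.mx_pos; have := hp.my_pos
  rw [Params.M₂, div_pow, mul_pow, mul_pow, h1, h2, Params.cond]
  field_simp
  ring

theorem one_le_Lmx : 1 ≤ p.L / p.mx := by
  rw [one_le_div hp.mx_pos]; exact hp.mx_le

theorem one_le_Lmy : 1 ≤ p.L / p.my := by
  rw [one_le_div hp.my_pos]; exact hp.my_le

omit hp in
theorem cond_eq : p.cond = p.L / p.mx * (p.L / p.my) := by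
  rw [Params.cond]; field_simp

theorem Lmx_le_cond : p.L / p.mx ≤ p.cond := by
  rw [Params.Valid.cond_eq]
  exact le_mul_of_one_le_right (by linarith [hp.one_le_Lmx]) hp.one_le_Lmy

theorem Lmy_le_cond : p.L / p.my ≤ p.cond := by
  rw [Params.Valid.cond_eq]
  exact le_mul_of_one_le_left (by linarith [hp.one_le_Lmy]) hp.one_le_Lmx

theorem one_le_cond : 1 ≤ p.cond := hp.one_le_Lmx.trans hp.Lmx_le_cond

theorem cond_pos : 0 < p.cond := one_pos.trans_le hp.one_le_cond

theorem L_div_min_le : p.L / min p.mx p.my ≤ p.cond := by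
  rcases min_choice p.mx p.my with h | h <;> rw [h]
  · exact hp.Lmx_le_cond
  · exact hp.Lmy_le_cond

omit hp in
theorem one_le_logCond : 1 ≤ p.logCond := le_max_left _ _

omit hp in
theorem log_cond_le : Real.log p.cond ≤ p.logCond := le_max_right _ _

/-- The rate of the inner proximal loop dominates the relative accuracy of ABR. -/
theorem inner_accuracy : 1 / p.M₂ ≤ proxRate (p.β₂ / p.my) ^ 2 / 20 ∧
    2 * p.L * (1 / p.M₂) ^ 2 ≤ p.my * proxRate (p.β₂ / p.my) / 1600 := by
  have hβ := hp.β₂_pos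
  have hL := hp.L_pos
  have hm := hp.my_pos
  have hx := hp.mx_pos
  have hα := proxRate_sq (κ := p.β₂ / p.my) (by positivity)
  have hα0 := proxRate_pos (κ := p.β₂ / p.my) (by positivity)
  set α := proxRate (p.β₂ / p.my)
  have hα1 : p.my / p.L / 4 ≤ α ^ 2 := by
    rw [hα, div_div, ← mul_div_assoc, one_div_div]
    rw [mul_comm p.L]
    gcongr
    exact hp.β₂_le
  have ht0 : 0 < p.my / p.L := by positivity
  have ht1 : p.my / p.L ≤ 1 := (div_le_one hL).2 hp.my_le
  -- With `t = my/L` both requirements become polynomial in `t ≤ 1`, since `t/4 ≤ α²`.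
  have hδ : (1 / p.M₂) ^ 2 ≤ (p.my / p.L) ^ 3 / 9216 := by
    rw [div_pow, hp.M₂_sq, Params.Valid.cond_eq]
    have h1 : 9216 * (1 * (p.L / p.my)) ^ 2 * (p.L / p.my)
        ≤ 9216 * (p.L / p.mx * (p.L / p.my)) ^ 2 * (p.L / p.my) := by
      gcongr
      exact hp.one_le_Lmx
    calc 1 ^ 2 / (9216 * ((p.L / p.mx * (p.L / p.my)) ^ 2 * (p.L / p.my)))
        ≤ 1 ^ 2 / (9216 * (1 * (p.L / p.my)) ^ 2 * (p.L / p.my)) := by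
          rw [← mul_assoc]
          exact div_le_div_of_nonneg_left (by norm_num) (by positivity) h1
      _ = _ := by field_simp
  generalize hs : p.my / p.L = t at *
  have hmL : p.my = t * p.L := by rw [← hs]; field_simp
  have hM := hp.M₂_pos
  constructor
  · refine abs_le_of_sq_le_sq' ?_ (by positivity) |>.2
    have h2 := pow_le_pow_left₀ (by positivity) hα1 2
    calc (1 / p.M₂) ^ 2 ≤ t ^ 3 / 9216 := hδ
      _ = t ^ 2 / 9216 * t := by ring
      _ ≤ t ^ 2 / 9216 * 1 := by gcongr
      _ ≤ (t / 4) ^ 2 / 400 := by linarith [sq_nonneg t]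
      _ ≤ (α ^ 2) ^ 2 / 400 := by gcongr
      _ = _ := by ring
  · have hα2 : t / 2 ≤ α := by
      refine abs_le_of_sq_le_sq' ?_ hα0.le |>.2
      refine le_trans ?_ hα1
      have : t * t ≤ t * 1 := by gcongr
      linarith
    rw [hmL]
    calc 2 * p.L * (1 / p.M₂) ^ 2 ≤ 2 * p.L * (t ^ 3 / 9216) := by gcongr
      _ = t * p.L * (t / 2) * t * (4 / 9216) := by ring
      _ ≤ t * p.L * α * 1 * (4 / 9216) := by gcongr
      _ ≤ _ := by
        have : 0 < t * p.L * α := by positivity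
        linarith

/-- The rate of the outer proximal loop dominates the relative accuracy of APPA-ABR. -/
theorem outer_accuracy : p.L / p.my * (1 / p.M₁) ≤ proxRate (p.β₁ / p.mx) ^ 2 / 20 ∧
    2 * p.L ^ 2 / p.my * (p.L / p.my * (1 / p.M₁)) ^ 2
      ≤ p.mx * proxRate (p.β₁ / p.mx) / 1600 := by
  have hβ := hp.β₁_pos
  have hL := hp.L_pos
  have hm := hp.my_pos
  have hx := hp.mx_pos
  have hα := proxRate_sq (κ := p.β₁ / p.mx) (by positivity)
  have hα0 := proxRate_pos (κ := p.β₁ / p.mx) (by positivity)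
  set α := proxRate (p.β₁ / p.mx)
  have hα1 : p.mx / p.L / 4 ≤ α ^ 2 := by
    rw [hα, div_div, ← mul_div_assoc, one_div_div]
    rw [mul_comm p.L]
    gcongr
    exact hp.β₁_le
  have ht0 : 0 < p.mx / p.L := by positivity
  have ht1 : p.mx / p.L ≤ 1 := (div_le_one hL).2 hp.mx_le
  have hu0 : 0 < p.my / p.L := by positivity
  have hu1 : p.my / p.L ≤ 1 := (div_le_one hL).2 hp.my_le
  have hδ : (p.L / p.my * (1 / p.M₁)) ^ 2 = (p.mx / p.L) ^ 3 * (p.my / p.L) / 6400 := by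
    rw [mul_pow, div_pow 1, hp.M₁_sq, Params.cond]
    field_simp
  generalize hs : p.mx / p.L = t at *
  generalize hu : p.my / p.L = u at *
  have hmL : p.mx = t * p.L := by rw [← hs]; field_simp
  have hmL' : p.my = u * p.L := by rw [← hu]; field_simp
  have hM := hp.M₁_pos
  constructor
  · refine abs_le_of_sq_le_sq' ?_ (by positivity) |>.2
    rw [hδ]
    calc t ^ 3 * u / 6400 = t ^ 2 / 6400 * (t * u) := by ring
      _ ≤ t ^ 2 / 6400 * (1 * 1) := by gcongr
      _ = (t / 4) ^ 2 / 400 := by ring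
      _ ≤ (α ^ 2) ^ 2 / 400 := by gcongr
      _ = _ := by ring
  · have hα2 : t / 2 ≤ α := by
      refine abs_le_of_sq_le_sq' ?_ hα0.le |>.2
      refine le_trans ?_ hα1
      have : t * t ≤ t * 1 := by gcongr
      linarith
    rw [hδ, hmL, hmL']
    calc 2 * p.L ^ 2 / (u * p.L) * (t ^ 3 * u / 6400)
        = t * p.L * (t / 2) * t * (4 / 6400) := by field_simp; ring
      _ ≤ t * p.L * α * 1 * (4 / 6400) := by gcongr
      _ = _ := by ring

end Params.Valid

/-- The number of gradient evaluations of one call of ABR. -/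
noncomputable def Params.abrCalls (p : Params) : ℕ :=
  ⌈Real.logb 2 (4 * √(3 * p.L / (2 * p.β₁) + 3 * p.L / (2 * p.β₂)) / (1 / p.M₂))⌉₊ *
    (⌈2 * √(3 * p.L / (2 * p.β₁)) * Real.log (24 * (3 * p.L / (2 * p.β₁)))⌉₊ +
      ⌈2 * √(3 * p.L / (2 * p.β₂)) * Real.log (24 * (3 * p.L / (2 * p.β₂)))⌉₊)

/-- A bound for the number of iterations of one call of APPA-ABR. -/
noncomputable def Params.appaIters (p : Params) : ℕ :=
  ⌈4 * √(p.β₂ / p.my) * (28 * p.logCond)⌉₊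

/-! ### One call of APPA-ABR. -/

variable {n m : ℕ} {p : Params} {g : Vec n → Vec m → ℝ} {gx : Vec n → Vec m → Vec n}
  {gy : Vec n → Vec m → Vec m} {O : Oracle n m}

theorem appaBody_calls (hO : ∀ z, (O z).calls = 1) (s : Pt n m × Vec m) :
    (appaBody p O s).calls = p.abrCalls := by
  simp only [appaBody, Counted.bind_calls, Counted.pure_calls, add_zero, Params.abrCalls]
  exact abr_calls (fun z => by simp [proxY, hO]) _ _ _ _ _ _

/-- The choice of `β₁` and `β₂` gives `Lxy² ≤ β₁β₂`, which is the weak coupling that `abr_contract`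
needs for the moduli `2β₁`, `2β₂`. All smoothness constants stay below `3L`. -/
theorem appaBody_contract (hp : p.Valid)
    (hg : SaddleClass g gx gy (p.mx + 2 * p.β₁) p.my (p.L + 2 * p.β₁) p.Lxy p.L)
    (hO : ∀ z, (O z).val = (gx z.1 z.2, gy z.1 z.2)) (s : Pt n m × Vec m) (q : Pt n m)
    (hqx : gx q.1 q.2 = 0) (hqy : gy q.1 q.2 - (2 * p.β₂) • (q.2 - s.2) = 0) :
    enorm2 ((appaBody p O s).val.1 - q) ≤ 1 / p.M₂ * enorm2 (s.1 - q) := by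
  have hx := hp.mx_pos
  have hy := hp.my_pos
  have h1 := hp.β₁_pos
  have h2 := hp.β₂_pos
  have h3 := hp.β₁_le
  have h4 := hp.β₂_le
  have hL := hp.L_pos
  have hcl := (hg.proxY h2.le s.2).mono (mx' := 2 * p.β₁) (my' := 2 * p.β₂) (Lx' := 3 * p.L)
    (Ly' := 3 * p.L) (by linarith) (by linarith) (by linarith) (le_refl p.Lxy) (by linarith)
  refine abr_contract hcl (by positivity) (by positivity) (by linarith) (by linarith) le_rfl
    le_rfl ?_ (fun z => by simp [proxY, hO]) hqx hqy (by have := hp.M₂_pos; positivity) s.1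
  have h5 : p.Lxy * p.Lxy ≤ p.β₁ * p.β₂ :=
    mul_le_mul (le_max_right _ _) (le_max_right _ _) hp.Lxy_nonneg h1.le
  linarith

/-- Gradient norm and distance to the saddle point are comparable, with factors `min mx my` and
`4L`. Contraction of the potential therefore forces the gradient test to succeed, and its success,
however early, certifies the accuracy. -/
theorem appaAbr_exists (hp : p.Valid)
    (hg : SaddleClass g gx gy (p.mx + 2 * p.β₁) p.my (p.L + 2 * p.β₁) p.Lxy p.L)
    (hO : ∀ z, (O z).val = (gx z.1 z.2, gy z.1 z.2)) (hOc : ∀ z, (O z).calls = 1)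
    {zs : Pt n m} (hxs : gx zs.1 zs.2 = 0) (hys : gy zs.1 zs.2 = 0) (z₀ : Pt n m) :
    ∃ r, AppaAbr p O z₀ p.M₁ r ∧ enorm2 (r.val - zs) ≤ 1 / p.M₁ * enorm2 (z₀ - zs) ∧
      r.calls ≤ 1 + p.appaIters * (p.abrCalls + 1) := by
  have hx := hp.mx_pos
  have hy := hp.my_pos
  have hβ1 := hp.β₁_pos
  have hβ2 := hp.β₂_pos
  have hL := hp.L_pos
  have hM1 := hp.M₁_pos
  have hM2 := hp.M₂_pos
  obtain ⟨hδ1, hδ2⟩ := hp.inner_accuracy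
  have hκ : 0 < p.β₂ / p.my := by positivity
  -- The proximal loop is in `y`, hence the swap. The response is now the minimizer in `x`, where
  -- the modulus `mx + 2β₁` exceeds `Lxy`; so `ρ = 1` works.
  obtain ⟨Φ, hΦd, hΦ0, hΦs⟩ := hg.swap.exists_potential hy (by positivity) hp.Lxy_nonneg
    (β := p.β₂) (ρ := 1) (Λ := 2 * p.L) (δ := 1 / p.M₂) (le_max_left _ _) le_rfl
    (by have : p.Lxy ≤ p.β₁ := le_max_right _ _
        linarith) (by positivity)
    (by have : p.Lxy ≤ p.L := Params.Valid.Lxy_le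
        linarith) (by positivity) (by rw [one_mul]; exact hδ1)
    (by rw [one_mul]; exact hδ2) (zs := zs.swap) (neg_eq_zero.2 hys) (neg_eq_zero.2 hxs)
  set α := proxRate (p.β₂ / p.my) with hα
  have hα0 : 0 < α := proxRate_pos hκ
  have hα1 : α ≤ 1 := by
    rw [hα, proxRate, div_le_one (by positivity)]
    have : 1 ≤ √(p.β₂ / p.my) := by
      rw [Real.one_le_sqrt, one_le_div hy]; exact le_max_left _ _
    linarith
  let F : Pt n m × Vec m → Pt n m × Vec m := fun s => (appaBody p O s).val
  have hiter : ∀ k, Φ (F^[k] (z₀, z₀.2)).1.swap (F^[k] (z₀, z₀.2)).2 ≤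
      (1 - α / 2) ^ k * ((2 * p.L + 9 / 4 * p.my) * enorm2 (z₀ - zs) ^ 2) := by
    intro k
    induction k with
    | zero =>
      have := hΦ0 z₀.swap
      rw [← Prod.swap_sub, enorm2_swap] at this
      simpa using this
    | succ k ih =>
      rw [Function.iterate_succ_apply', pow_succ', mul_assoc]
      generalize F^[k] (z₀, z₀.2) = s at ih ⊢
      refine (hΦs s.1.swap s.2 (F s).1.swap ?_).trans
        (mul_le_mul_of_nonneg_left ih (by linarith))
      intro q hq1 hq2
      have := appaBody_contract hp hg hO s q.swap (neg_eq_zero.1 hq2) (by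
        rw [← neg_eq_zero, neg_sub, sub_eq_add_neg, add_comm]; exact hq1)
      rw [← enorm2_swap, ← enorm2_swap (s.1 - q.swap)] at this
      simpa using this
  set K := p.appaIters with hK
  have hlog := Params.Valid.one_le_logCond (p := p)
  have hKge : 4 * √(p.β₂ / p.my) * (28 * p.logCond) ≤ K := Nat.le_ceil _
  have hKpos : 0 < K := Nat.ceil_pos.2 (by positivity)
  set μ := min p.mx p.my with hμ
  have hμ0 : 0 < μ := lt_min hx hy
  -- The `28` in `appaIters` splits as `20 + 8`. The eighth power of `cond` covers `M₁²` (third),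
  -- `(L/μ)⁴` (fourth) and `L/my` (first); `e²⁰` beats the numerical constants.
  have hrate : (1 - α / 2) ^ K ≤ (Real.exp 20 * p.cond ^ 8)⁻¹ := by
    have hc := hp.cond_pos
    refine one_sub_pow_le_inv (by linarith) (by positivity) ?_
    rw [Real.log_mul (by positivity) (by positivity), Real.log_exp, Real.log_pow]
    have h1 := Params.Valid.log_cond_le (p := p)
    have h2 : α / 2 * (4 * √(p.β₂ / p.my) * (28 * p.logCond)) = 28 * p.logCond := by
      rw [hα, proxRate]; field_simp; norm_num
    have h3 := mul_le_mul_of_nonneg_left hKge (by positivity : 0 ≤ α / 2)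
    push_cast
    linarith
  have hgrad0 : μ * enorm2 (z₀ - zs) ≤ enorm2 (gx z₀.1 z₀.2, gy z₀.1 z₀.2) := by
    refine le_trans ?_ (hg.min_mul_le_enorm2_grad hxs hys z₀)
    refine mul_le_mul_of_nonneg_right ?_ (enorm2_nonneg _)
    exact min_le_min_right _ (by linarith)
  have hgradL : ∀ z, enorm2 (gx z.1 z.2, gy z.1 z.2) ≤ 4 * p.L * enorm2 (z - zs) := fun z =>
    hg.enorm2_grad_le hL.le (by linarith [hp.β₁_le]) Params.Valid.Lxy_le le_rfl hxs hys z
  have hdone : (appaDone p p.M₁ O (O z₀).val (F^[K - 1 + 1] (z₀, z₀.2))).val := by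
    rw [Nat.sub_add_cancel hKpos]
    simp only [appaDone, Counted.bind_val, Counted.pure_val, hO]
    set w := (F^[K] (z₀, z₀.2)).1
    have h1 : enorm2 (w - zs) ^ 2 ≤ 6 / p.my * ((Real.exp 20 * p.cond ^ 8)⁻¹ *
        ((2 * p.L + 9 / 4 * p.my) * enorm2 (z₀ - zs) ^ 2)) := by
      have h2 := hΦd w.swap (F^[K] (z₀, z₀.2)).2
      rw [← Prod.swap_sub, enorm2_swap, one_pow, mul_one] at h2
      refine h2.trans (mul_le_mul_of_nonneg_left ((hiter K).trans ?_) (by positivity))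
      gcongr
    have h3 : 4 * p.L * enorm2 (w - zs) ≤ μ / (9 * p.L * p.M₁) * (μ * enorm2 (z₀ - zs)) := by
      refine abs_le_of_sq_le_sq' ?_
        (mul_nonneg (by positivity) (mul_nonneg hμ0.le (enorm2_nonneg _))) |>.2
      rw [mul_pow (4 * p.L)]
      refine (mul_le_mul_of_nonneg_left h1 (by positivity)).trans ?_
      have hc := hp.cond_pos
      have hc1 := hp.L_div_min_le
      rw [← hμ] at hc1
      have hc2 := hp.Lmy_le_cond
      have e1 : (μ / (9 * p.L * p.M₁) * (μ * enorm2 (z₀ - zs))) ^ 2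
          = (1 / 81) * (p.M₁ ^ 2)⁻¹ * p.L ^ 2 * ((p.L / μ) ^ 4)⁻¹ * enorm2 (z₀ - zs) ^ 2 := by
        field_simp
        ring
      rw [e1, hp.M₁_sq]
      have e2 : (1 / 81) * (6400 * p.cond ^ 3)⁻¹ * p.L ^ 2 * (p.cond ^ 4)⁻¹ * enorm2 (z₀ - zs) ^ 2
          ≤ (1 / 81) * (6400 * p.cond ^ 3)⁻¹ * p.L ^ 2 * ((p.L / μ) ^ 4)⁻¹
            * enorm2 (z₀ - zs) ^ 2 := by gcongr
      refine le_trans ?_ e2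
      have e3 : (4 * p.L) ^ 2 * (6 / p.my * ((Real.exp 20 * p.cond ^ 8)⁻¹ *
          ((2 * p.L + 9 / 4 * p.my) * enorm2 (z₀ - zs) ^ 2)))
          = (96 * (Real.exp 20)⁻¹ * (2 * (p.L / p.my) + 9 / 4)) *
            (p.L ^ 2 * (p.cond ^ 8)⁻¹ * enorm2 (z₀ - zs) ^ 2) := by
        field_simp; ring
      have e4 : (1 / 81) * (6400 * p.cond ^ 3)⁻¹ * p.L ^ 2 * (p.cond ^ 4)⁻¹ * enorm2 (z₀ - zs) ^ 2
          = (p.cond / 518400) * (p.L ^ 2 * (p.cond ^ 8)⁻¹ * enorm2 (z₀ - zs) ^ 2) := by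
        field_simp; ring
      rw [e3, e4]
      refine mul_le_mul_of_nonneg_right ?_ (by positivity)
      have hexp : 96 * (Real.exp 20)⁻¹ ≤ 1 / 2203200 := by
        have h5 : (2.7 : ℝ) ^ 20 ≤ Real.exp 20 := by
          have h6 : Real.exp 20 = Real.exp 1 ^ 20 := by rw [← Real.exp_nat_mul]; norm_num
          rw [h6]
          have := Real.exp_one_gt_d9
          gcongr
          linarith
        have h7 : (2203200 * 96 : ℝ) ≤ 2.7 ^ 20 := by norm_num
        rw [mul_inv_le_iff₀ (by positivity)]
        linarith
      have h8 := hp.one_le_cond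
      calc 96 * (Real.exp 20)⁻¹ * (2 * (p.L / p.my) + 9 / 4)
          ≤ 1 / 2203200 * (2 * p.cond + 9 / 4 * p.cond) := by
            gcongr
            linarith
        _ = p.cond / 518400 := by ring
    calc enorm2 (gx w.1 w.2, gy w.1 w.2) ≤ 4 * p.L * enorm2 (w - zs) := hgradL w
      _ ≤ μ / (9 * p.L * p.M₁) * (μ * enorm2 (z₀ - zs)) := h3
      _ ≤ _ := by gcongr
  obtain ⟨q, hq, hqd, hqc⟩ := RepeatUntil.exists_of_iterate (appaBody_calls (p := p) hOc)
    (d := 1) (fun s => by simp [appaDone, hOc]) (K - 1) (z₀, z₀.2) hdone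
  refine ⟨_, ⟨q, hq, rfl⟩, ?_, ?_⟩
  · simp only [appaDone, Counted.bind_val, Counted.pure_val, hO] at hqd
    set w := q.val.1
    have h1 := (hg.min_mul_le_enorm2_grad hxs hys w)
    have h2 : μ * enorm2 (w - zs) ≤ enorm2 (gx w.1 w.2, gy w.1 w.2) := by
      refine le_trans ?_ h1
      exact mul_le_mul_of_nonneg_right (min_le_min_right _ (by linarith)) (enorm2_nonneg _)
    have h3 := hgradL z₀
    -- The `9` in the test exceeds the `4` of the Lipschitz bound.
    have h4 : μ * enorm2 (w - zs) ≤ μ * (1 / p.M₁ * enorm2 (z₀ - zs)) := by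
      calc μ * enorm2 (w - zs) ≤ _ := h2.trans hqd
        _ ≤ μ / (9 * p.L * p.M₁) * (4 * p.L * enorm2 (z₀ - zs)) := by gcongr
        _ = 4 / 9 * (μ * (1 / p.M₁ * enorm2 (z₀ - zs))) := by field_simp
        _ ≤ _ := by
          have : 0 ≤ μ * (1 / p.M₁ * enorm2 (z₀ - zs)) :=
            mul_nonneg hμ0.le (mul_nonneg (by positivity) (enorm2_nonneg _))
          linarith
    exact le_of_mul_le_mul_left h4 hμ0
  · simp only [hOc]
    rw [Nat.sub_add_cancel hKpos] at hqc
    omega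

end Minimax
-- Counting gradient evaluations.
namespace Minimax

/-- A bound for the number of gradient evaluations of one iteration of Proximal Best Response. -/
noncomputable def Params.iterCalls (p : Params) : ℕ := 1 + p.appaIters * (p.abrCalls + 1)

/-- `L/mₓ + L Lₓᵧ/(mₓ m_y) + L/m_y`. -/
noncomputable def Params.complexity (p : Params) : ℝ :=
  p.L / p.mx + p.L * p.Lxy / (p.mx * p.my) + p.L / p.my

theorem ceil_le_add_one_mul {a b c : ℝ} (ha : 0 ≤ a) (hac : a ≤ c * b) (hb : 1 ≤ b) :
    (⌈a⌉₊ : ℝ) ≤ (c + 1) * b := by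
  have := (Nat.ceil_lt_add_one ha).le
  linarith

theorem agd_steps_le {κ c Λ : ℝ} (hκ1 : 1 ≤ κ) (hΛ : 1 ≤ Λ) (hc : 0 < c) (hκ : κ ≤ 3 / 2 * c)
    (hlog : Real.log c ≤ Λ) :
    (⌈2 * √κ * Real.log (24 * κ)⌉₊ : ℝ) ≤ 11 * (√κ * Λ) := by
  have hs : 1 ≤ √κ := Real.one_le_sqrt.2 hκ1
  have h1 : Real.log (24 * κ) ≤ 5 * Λ := by
    have h2 : Real.log (24 * κ) ≤ Real.log (36 * c) :=
      Real.log_le_log (by positivity) (by linarith)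
    rw [Real.log_mul (by norm_num) hc.ne'] at h2
    have h3 : Real.log 36 ≤ 4 := by
      rw [Real.log_le_iff_le_exp (by norm_num)]
      have h6 : Real.exp 4 = Real.exp 1 ^ 4 := by rw [← Real.exp_nat_mul]; norm_num
      rw [h6]
      have := Real.exp_one_gt_d9
      calc (36 : ℝ) ≤ 2.7 ^ 4 := by norm_num
        _ ≤ _ := by gcongr; linarith
    linarith
  have h0 : 0 ≤ Real.log (24 * κ) := Real.log_nonneg (by linarith)
  have := ceil_le_add_one_mul (a := 2 * √κ * Real.log (24 * κ)) (b := √κ * Λ) (c := 10)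
    (by positivity)
    (by calc 2 * √κ * Real.log (24 * κ) ≤ 2 * √κ * (5 * Λ) := by gcongr
          _ = _ := by ring)
    (one_le_mul_of_one_le_of_one_le hs hΛ)
  linarith

namespace Params.Valid

variable {p : Params}

theorem one_le_kappa_abr {β : ℝ} (hβ : 0 < β) (hβL : β ≤ p.L) :
    1 ≤ 3 * p.L / (2 * β) := by
  rw [one_le_div (by positivity)]
  linarith

theorem kappa_abr_le (hp : p.Valid) {β μ : ℝ} (hμ : 0 < μ) (hβ : μ ≤ β) :
    3 * p.L / (2 * β) ≤ 3 / 2 * (p.L / μ) := by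
  have hL := hp.L_pos
  calc 3 * p.L / (2 * β) = 3 / 2 * (p.L / β) := by ring
    _ ≤ _ := by gcongr

theorem abr_rounds_le (hp : p.Valid) :
    (⌈Real.logb 2 (4 * √(3 * p.L / (2 * p.β₁) + 3 * p.L / (2 * p.β₂)) / (1 / p.M₂))⌉₊ : ℝ)
      ≤ 14 * p.logCond := by
  have h1 := one_le_kappa_abr hp.β₁_pos hp.β₁_le
  have h2 := one_le_kappa_abr hp.β₂_pos hp.β₂_le
  have h3 : 3 * p.L / (2 * p.β₁) ≤ 3 / 2 * (p.L / p.mx) :=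
    hp.kappa_abr_le hp.mx_pos (le_max_left _ _)
  have h4 : 3 * p.L / (2 * p.β₂) ≤ 3 / 2 * (p.L / p.my) :=
    hp.kappa_abr_le hp.my_pos (le_max_left _ _)
  have h5 := hp.Lmx_le_cond
  have h6 := hp.Lmy_le_cond
  have hc := hp.cond_pos
  have hc1 := hp.one_le_cond
  have hM := hp.M₂_pos
  have hΛ := Params.Valid.one_le_logCond (p := p)
  have hl := Params.Valid.log_cond_le (p := p)
  have hL1 := hp.one_le_Lmy
  have hM2 := hp.M₂_sq
  generalize 3 * p.L / (2 * p.β₁) = kx at *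
  generalize 3 * p.L / (2 * p.β₂) = ky at *
  rw [div_div_eq_mul_div, div_one]
  set X := 4 * √(kx + ky) * p.M₂ with hX
  have hk : 0 < kx + ky := by linarith
  have hX0 : 0 < X := by positivity
  -- Here `kx + ky ≤ 3 cond` and `M₂² ≤ 9216 cond³`. Taking logarithms, `19/2 + 2/log 2 < 13`.
  have hX2 : X ^ 2 ≤ 2 ^ 19 * p.cond ^ 4 := by
    rw [hX, mul_pow, mul_pow, Real.sq_sqrt hk.le, hM2]
    calc 4 ^ 2 * (kx + ky) * (9216 * (p.cond ^ 2 * (p.L / p.my)))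
        ≤ 4 ^ 2 * (3 * p.cond) * (9216 * (p.cond ^ 2 * p.cond)) := by
          gcongr
          linarith
      _ = 442368 * p.cond ^ 4 := by ring
      _ ≤ _ := by gcongr; norm_num
  have hlog2 := Real.log_two_gt_d9
  have hlogX : Real.logb 2 X ≤ 13 * p.logCond := by
    have h7 := Real.log_le_log (by positivity) hX2
    rw [Real.log_mul (by positivity) (by positivity), Real.log_pow, Real.log_pow, Real.log_pow] at h7
    push_cast at h7
    rw [Real.logb, div_le_iff₀ (by linarith)]
    have h8 : p.logCond * 0.69 ≤ p.logCond * Real.log 2 := by gcongr; linarith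
    have h9 : 1 * Real.log 2 ≤ p.logCond * Real.log 2 := by gcongr
    linarith
  by_cases h0 : 0 ≤ Real.logb 2 X
  · have := ceil_le_add_one_mul h0 hlogX hΛ
    linarith
  · rw [Nat.ceil_eq_zero.2 (le_of_not_ge h0), Nat.cast_zero]
    positivity

theorem abrCalls_le (hp : p.Valid) : (p.abrCalls : ℝ) ≤
    154 * p.logCond ^ 2 * (√(3 * p.L / (2 * p.β₁)) + √(3 * p.L / (2 * p.β₂))) := by
  have hΛ := Params.Valid.one_le_logCond (p := p)
  have hl := Params.Valid.log_cond_le (p := p)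
  have h1 := agd_steps_le (one_le_kappa_abr hp.β₁_pos hp.β₁_le) hΛ hp.cond_pos
    ((hp.kappa_abr_le hp.mx_pos (le_max_left p.mx p.Lxy : p.mx ≤ p.β₁)).trans
      (by linarith [hp.Lmx_le_cond])) hl
  have h2 := agd_steps_le (one_le_kappa_abr hp.β₂_pos hp.β₂_le) hΛ hp.cond_pos
    ((hp.kappa_abr_le hp.my_pos (le_max_left p.my p.Lxy : p.my ≤ p.β₂)).trans
      (by linarith [hp.Lmy_le_cond])) hl
  have h3 := hp.abr_rounds_le
  rw [Params.abrCalls]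
  push_cast
  calc _ ≤ (14 * p.logCond) * (11 * (√(3 * p.L / (2 * p.β₁)) * p.logCond)
        + 11 * (√(3 * p.L / (2 * p.β₂)) * p.logCond)) := by gcongr
    _ = _ := by ring

theorem appaIters_le (hp : p.Valid) :
    (p.appaIters : ℝ) ≤ 113 * (√(p.β₂ / p.my) * p.logCond) := by
  have hΛ := Params.Valid.one_le_logCond (p := p)
  have hs : 1 ≤ √(p.β₂ / p.my) := by
    rw [Real.one_le_sqrt, one_le_div hp.my_pos]; exact le_max_left _ _
  have := ceil_le_add_one_mul (a := 4 * √(p.β₂ / p.my) * (28 * p.logCond))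
    (b := √(p.β₂ / p.my) * p.logCond) (c := 112) (by positivity) (by linarith)
    (one_le_mul_of_one_le_of_one_le hs hΛ)
  rw [Params.appaIters]
  linarith

theorem iterCalls_le (hp : p.Valid) : (p.iterCalls : ℝ) ≤ 17600 * p.logCond ^ 3 *
    (√(p.β₂ / p.my) * (√(3 * p.L / (2 * p.β₁)) + √(3 * p.L / (2 * p.β₂)))) := by
  have hΛ := Params.Valid.one_le_logCond (p := p)
  have hs : 1 ≤ √(p.β₂ / p.my) := by
    rw [Real.one_le_sqrt, one_le_div hp.my_pos]; exact le_max_left _ _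
  have h1 := Real.one_le_sqrt.2 (one_le_kappa_abr hp.β₁_pos hp.β₁_le)
  have h2 := hp.abrCalls_le
  have h3 := hp.appaIters_le
  have h4 := Real.sqrt_nonneg (3 * p.L / (2 * p.β₂))
  generalize √(3 * p.L / (2 * p.β₁)) = a at *
  generalize √(3 * p.L / (2 * p.β₂)) = b at *
  generalize √(p.β₂ / p.my) = s at *
  generalize p.logCond = Λ at *
  have hab : 1 ≤ a + b := by linarith
  have h5 : 1 ≤ Λ ^ 2 * (a + b) := one_le_mul_of_one_le_of_one_le (one_le_pow₀ hΛ) hab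
  have h6 : 1 ≤ Λ ^ 3 * (s * (a + b)) := one_le_mul_of_one_le_of_one_le (one_le_pow₀ hΛ)
    (one_le_mul_of_one_le_of_one_le hs hab)
  rw [Params.iterCalls]
  push_cast
  calc (1 : ℝ) + p.appaIters * (p.abrCalls + 1)
      ≤ Λ ^ 3 * (s * (a + b)) + 113 * (s * Λ) * (154 * Λ ^ 2 * (a + b) + Λ ^ 2 * (a + b)) := by
        gcongr
    _ = 17516 * (Λ ^ 3 * (s * (a + b))) := by ring
    _ ≤ 17600 * (Λ ^ 3 * (s * (a + b))) := by gcongr; norm_num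
    _ = _ := by ring

/-- The product of the square roots of the three condition numbers is the complexity. -/
theorem sqrt_kappa_mul_le (hp : p.Valid) : √(p.β₁ / p.mx) *
    (√(p.β₂ / p.my) * (√(3 * p.L / (2 * p.β₁)) + √(3 * p.L / (2 * p.β₂))))
      ≤ 5 / 2 * √p.complexity := by
  have hx := hp.mx_pos
  have hy := hp.my_pos
  have hβ1 := hp.β₁_pos
  have hβ2 := hp.β₂_pos
  have hL := hp.L_pos
  have hxy := hp.Lxy_nonneg
  -- Here `β₁` cancels, in `e2` `β₂` does. Without this cancellation the regularization would not
  -- pay off.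
  have e1 : √(p.β₁ / p.mx) * (√(p.β₂ / p.my) * √(3 * p.L / (2 * p.β₁)))
      = √(3 / 2 * (p.L * p.β₂ / (p.mx * p.my))) := by
    rw [← Real.sqrt_mul (by positivity), ← Real.sqrt_mul (by positivity)]
    congr 1; field_simp
  have e2 : √(p.β₁ / p.mx) * (√(p.β₂ / p.my) * √(3 * p.L / (2 * p.β₂)))
      = √(3 / 2 * (p.L * p.β₁ / (p.mx * p.my))) := by
    rw [← Real.sqrt_mul (by positivity), ← Real.sqrt_mul (by positivity)]
    congr 1; field_simp
  have hQ0 : 0 ≤ p.complexity := by unfold Params.complexity; positivity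
  have h3 : ∀ q : ℝ, q ≤ p.complexity → √(3 / 2 * q) ≤ 5 / 4 * √p.complexity := by
    intro q hq
    rw [Real.sqrt_le_left (by positivity), mul_pow, Real.sq_sqrt hQ0]
    linarith
  have h1 : p.L * p.β₂ / (p.mx * p.my) ≤ p.complexity := by
    have h : p.β₂ ≤ p.my + p.Lxy := max_le (by linarith) (by linarith)
    calc p.L * p.β₂ / (p.mx * p.my) ≤ p.L * (p.my + p.Lxy) / (p.mx * p.my) := by gcongr
      _ = p.L / p.mx + p.L * p.Lxy / (p.mx * p.my) := by field_simp
      _ ≤ _ := by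
        have : 0 < p.L / p.my := by positivity
        unfold Params.complexity; linarith
  have h2 : p.L * p.β₁ / (p.mx * p.my) ≤ p.complexity := by
    have h : p.β₁ ≤ p.mx + p.Lxy := max_le (by linarith) (by linarith)
    calc p.L * p.β₁ / (p.mx * p.my) ≤ p.L * (p.mx + p.Lxy) / (p.mx * p.my) := by gcongr
      _ = p.L / p.my + p.L * p.Lxy / (p.mx * p.my) := by field_simp
      _ ≤ _ := by
        have : 0 < p.L / p.mx := by positivity
        unfold Params.complexity; linarith
  rw [mul_add, mul_add, e1, e2]
  linarith [h3 _ h1, h3 _ h2]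

end Params.Valid

/-! ### Convergence and cost of the outermost loop. -/

variable {n m : ℕ} {p : Params} {f : Vec n → Vec m → ℝ} {gx : Vec n → Vec m → Vec n}
  {gy : Vec n → Vec m → Vec m} {O : Oracle n m}

/-- Proximal Best Response completes any number of iterations and converges linearly. -/
theorem pbrRun_exists (hp : p.Valid)
    (hf : SaddleClass f gx gy p.mx p.my p.L p.Lxy p.L)
    (hO : ∀ z, (O z).val = (gx z.1 z.2, gy z.1 z.2)) (hOc : ∀ z, (O z).calls = 1)
    {zs : Pt n m} (hxs : gx zs.1 zs.2 = 0) (hys : gy zs.1 zs.2 = 0) (z₀ : Pt n m) (T : ℕ) :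
    ∃ s, PbrRun p O z₀ T s ∧ s.calls ≤ T * p.iterCalls ∧
      enorm2 (s.val.1 - zs) ^ 2 ≤ 26 * p.cond ^ 3 *
        ((1 - proxRate (p.β₁ / p.mx) / 2) ^ T * enorm2 (z₀ - zs) ^ 2) := by
  have hx := hp.mx_pos
  have hy := hp.my_pos
  have hβ1 := hp.β₁_pos
  have hL := hp.L_pos
  have hM1 := hp.M₁_pos
  obtain ⟨hδ1, hδ2⟩ := hp.outer_accuracy
  have hLxy : p.Lxy ≤ p.L := Params.Valid.Lxy_le
  -- In `y` nothing is regularized at this level: the response map is only `L/my`-Lipschitz, and the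
  -- gradient of the envelope has constant `L + L²/my ≤ 2L²/my`.
  obtain ⟨Φ, hΦd, hΦ0, hΦs⟩ := hf.exists_potential hx hy hp.Lxy_nonneg
    (β := p.β₁) (ρ := p.L / p.my) (Λ := 2 * p.L ^ 2 / p.my) (δ := 1 / p.M₁) (le_max_left _ _)
    hp.one_le_Lmy (by rw [div_mul_cancel₀ _ hy.ne']; exact hLxy) (by positivity)
    (by
      have h1 : p.Lxy * (p.L / p.my) ≤ p.L * (p.L / p.my) := by gcongr
      have h2 : p.L * 1 ≤ p.L * (p.L / p.my) := by gcongr; exact hp.one_le_Lmy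
      have h3 : 2 * p.L ^ 2 / p.my = 2 * (p.L * (p.L / p.my)) := by ring
      linarith) (by positivity) hδ1 hδ2 hxs hys
  set α := proxRate (p.β₁ / p.mx) with hα
  have hα0 : 0 < α := proxRate_pos (by positivity)
  have hα1 : α ≤ 1 := by
    rw [hα, proxRate, div_le_one (by positivity)]
    have : 1 ≤ √(p.β₁ / p.mx) := by
      rw [Real.one_le_sqrt, one_le_div hx]; exact le_max_left _ _
    linarith
  obtain ⟨s, hs, hsc, hsΦ⟩ : ∃ s, PbrRun p O z₀ T s ∧ s.calls ≤ T * p.iterCalls ∧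
      Φ s.val.1 s.val.2 ≤ (1 - α / 2) ^ T * ((2 * p.L ^ 2 / p.my + 9 / 4 * p.mx)
        * enorm2 (z₀ - zs) ^ 2) := by
    induction T with
    | zero => exact ⟨_, .init, by simp, by simpa using hΦ0 z₀⟩
    | succ T ih =>
      obtain ⟨s, hs, hsc, hsΦ⟩ := ih
      have hg := hf.proxX hβ1.le s.val.2
      obtain ⟨q, hq⟩ := hg.exists_zero (by positivity) hy hp.Lxy_nonneg
      obtain ⟨r, hr, hrd, hrc⟩ := appaAbr_exists (O := proxX O p.β₁ s.val.2) hp hg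
        (fun z => by simp [proxX, hO]) (fun z => by simp [proxX, hOc]) hq.1 hq.2 s.val.1
      refine ⟨_, .step T s r hs hr, ?_, ?_⟩
      · simp only [Params.iterCalls] at hsc ⊢
        linarith
      · rw [pow_succ', mul_assoc]
        refine (hΦs s.val.1 s.val.2 r.val ?_).trans
          (mul_le_mul_of_nonneg_left hsΦ (by linarith))
        intro q' hx' hy'
        -- The potential demands accuracy relative to any solution of the subproblem; uniqueness
        -- reduces this to the one already chosen.
        rw [hg.zero_unique (by positivity) hy ⟨hx', hy'⟩ hq]
        exact hrd
  refine ⟨s, hs, hsc, (hΦd s.val.1 s.val.2).trans ?_⟩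
  have hpow : 0 ≤ (1 - α / 2) ^ T := pow_nonneg (by linarith) _
  calc 6 * (p.L / p.my) ^ 2 / p.mx * Φ s.val.1 s.val.2
      ≤ 6 * (p.L / p.my) ^ 2 / p.mx * ((1 - α / 2) ^ T *
        ((2 * p.L ^ 2 / p.my + 9 / 4 * p.mx) * enorm2 (z₀ - zs) ^ 2)) := by gcongr
    _ = 6 * (p.L / p.my) ^ 2 * (2 * p.cond + 9 / 4) *
        ((1 - α / 2) ^ T * enorm2 (z₀ - zs) ^ 2) := by
      rw [Params.cond]; field_simp
    _ ≤ 6 * p.cond ^ 2 * (2 * p.cond + 9 / 4 * p.cond) *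
        ((1 - α / 2) ^ T * enorm2 (z₀ - zs) ^ 2) := by
      have := hp.Lmy_le_cond
      have := hp.one_le_cond
      gcongr
      linarith
    _ = 51 / 2 * (p.cond ^ 3 * ((1 - α / 2) ^ T * enorm2 (z₀ - zs) ^ 2)) := by ring
    _ ≤ 26 * (p.cond ^ 3 * ((1 - α / 2) ^ T * enorm2 (z₀ - zs) ^ 2)) := by
      have := hp.cond_pos
      gcongr
      norm_num
    _ = _ := by ring

/-- Proximal Best Response reduces the squared distance by a factor `e^A`, up to a polynomial in the
condition number, with a number of gradient evaluations proportional to `A`. -/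
theorem pbrRun_complexity (hp : p.Valid)
    (hf : SaddleClass f gx gy p.mx p.my p.L p.Lxy p.L)
    (hO : ∀ z, (O z).val = (gx z.1 z.2, gy z.1 z.2)) (hOc : ∀ z, (O z).calls = 1)
    {zs : Pt n m} (hxs : gx zs.1 zs.2 = 0) (hys : gy zs.1 zs.2 = 0) (z₀ : Pt n m) {A : ℝ}
    (hA : 1 ≤ A) :
    ∃ T s, PbrRun p O z₀ T s ∧
      enorm2 (s.val.1 - zs) ^ 2 ≤ 26 * p.cond ^ 3 * ((Real.exp A)⁻¹ * enorm2 (z₀ - zs) ^ 2) ∧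
      (s.calls : ℝ) ≤ 220000 * √p.complexity * p.logCond ^ 3 * A := by
  have hx := hp.mx_pos
  have hκ : 1 ≤ √(p.β₁ / p.mx) := by
    rw [Real.one_le_sqrt, one_le_div hx]; exact le_max_left _ _
  obtain ⟨s, hs, hsc, hsd⟩ := pbrRun_exists hp hf hO hOc hxs hys z₀
    ⌈4 * √(p.β₁ / p.mx) * A⌉₊
  set T := ⌈4 * √(p.β₁ / p.mx) * A⌉₊ with hT
  refine ⟨T, s, hs, hsd.trans ?_, ?_⟩
  · have hc := hp.cond_pos
    have hα1 : proxRate (p.β₁ / p.mx) ≤ 1 := by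
      rw [proxRate, div_le_one (by positivity)]; linarith
    have : (1 - proxRate (p.β₁ / p.mx) / 2) ^ T ≤ (Real.exp A)⁻¹ := by
      refine one_sub_pow_le_inv (by linarith) (Real.exp_pos A) ?_
      rw [Real.log_exp]
      have h1 : 4 * √(p.β₁ / p.mx) * A ≤ T := Nat.le_ceil _
      have h2 : proxRate (p.β₁ / p.mx) / 2 * (4 * √(p.β₁ / p.mx) * A) = A := by
        rw [proxRate]; field_simp; norm_num
      have h3 : 0 ≤ proxRate (p.β₁ / p.mx) / 2 := by unfold proxRate; positivity
      have := mul_le_mul_of_nonneg_left h1 h3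
      linarith
    gcongr
  · have hTle : (T : ℝ) ≤ 5 * (√(p.β₁ / p.mx) * A) := by
      have := ceil_le_add_one_mul (a := 4 * √(p.β₁ / p.mx) * A) (b := √(p.β₁ / p.mx) * A)
        (c := 4) (by positivity) (by linarith) (one_le_mul_of_one_le_of_one_le hκ hA)
      linarith
    have h1 := hp.iterCalls_le
    have h2 := hp.sqrt_kappa_mul_le
    have hΛ := Params.Valid.one_le_logCond (p := p)
    have h3 : (s.calls : ℝ) ≤ T * p.iterCalls := by exact_mod_cast hsc
    refine h3.trans ?_
    generalize √(p.β₂ / p.my) * (√(3 * p.L / (2 * p.β₁)) + √(3 * p.L / (2 * p.β₂))) = w at *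
    calc (T : ℝ) * p.iterCalls
        ≤ 5 * (√(p.β₁ / p.mx) * A) * (17600 * p.logCond ^ 3 * w) := by gcongr
      _ = 88000 * p.logCond ^ 3 * A * (√(p.β₁ / p.mx) * w) := by ring
      _ ≤ 88000 * p.logCond ^ 3 * A * (5 / 2 * √p.complexity) := by gcongr
      _ = _ := by ring

end Minimax
-- From the function class to its inequalities; saddle points as zeros of the gradient.
namespace Minimax

variable {n m : ℕ} {p : Params} {f : Vec n → Vec m → ℝ}

theorem gradient_neg {d : ℕ} (φ : Vec d → ℝ) (x : Vec d) :
    gradient (fun x => -φ x) x = -gradient φ x := by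
  simp only [gradient, fderiv_fun_neg, map_neg]

theorem MemF.saddleClass (hf : MemF p f) :
    SaddleClass f (gradX f) (gradY f) p.mx p.my p.Lx p.Lxy p.Ly where
  cvx x x' y := by
    rw [real_inner_comm]
    exact hf.stronglyConvex y x x'
  ccv x y y' := by
    have h := hf.stronglyConcave x y y'
    rw [gradient_neg, inner_neg_right, real_inner_comm] at h
    have : gradY f x y = gradient (f x) y := rfl
    rw [this]
    linarith
  smx x x' y := by
    have hd : Differentiable ℝ (fun x => f x y) :=
      hf.differentiable.comp (differentiable_id.prodMk (differentiable_const y))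
    exact le_quadratic_of_lipschitz_gradient hd (fun u v => hf.lip_x_x y u v) x x'
  smy x y y' := by
    have hd : Differentiable ℝ (fun y => -f x y) :=
      (hf.differentiable.comp ((differentiable_const x).prodMk differentiable_id)).neg
    have h := le_quadratic_of_lipschitz_gradient (l := p.Ly) hd (fun u v => by
      rw [gradient_neg, gradient_neg, ← neg_sub', norm_neg]; exact hf.lip_y_y x u v) y y'
    rw [gradient_neg, inner_neg_left] at h
    have : gradY f x y = gradient (f x) y := rfl
    rw [this]
    linarith
  lip_xx x x' y := hf.lip_x_x y x x'
  lip_yy x y y' := hf.lip_y_y x y y'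
  lip_xy x y y' := hf.lip_x_y x y y'
  lip_yx x x' y := hf.lip_y_x y x x'

theorem exists_norm_eq_one {d : ℕ} (hd : 0 < d) : ∃ v : Vec d, ‖v‖ = 1 :=
  ⟨EuclideanSpace.single ⟨0, hd⟩ 1, by simp⟩

/-- The quadratic lower and upper models are compared at a unit vector, which needs a nontrivial
space. -/
theorem MemF.mx_le_Lx (hf : MemF p f) (hn : 0 < n) : p.mx ≤ p.Lx := by
  obtain ⟨v, hv⟩ := exists_norm_eq_one hn
  have h1 := hf.saddleClass.cvx 0 v 0
  have h2 := hf.saddleClass.smx 0 v 0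
  rw [sub_zero, hv] at h1 h2
  linarith

theorem MemF.my_le_Ly (hf : MemF p f) (hm : 0 < m) : p.my ≤ p.Ly := by
  obtain ⟨v, hv⟩ := exists_norm_eq_one hm
  have h1 := hf.saddleClass.ccv 0 0 v
  have h2 := hf.saddleClass.smy 0 0 v
  rw [sub_zero, hv] at h1 h2
  linarith

theorem MemF.Lxy_nonneg (hf : MemF p f) (hm : 0 < m) : 0 ≤ p.Lxy := by
  obtain ⟨v, hv⟩ := exists_norm_eq_one hm
  have h1 := hf.saddleClass.lxy_mul_nonneg v 0
  rwa [sub_zero, hv, mul_one] at h1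

theorem MemF.isSaddlePoint_iff (hf : MemF p f) (hx : 0 ≤ p.mx) (hy : 0 ≤ p.my) (z : Pt n m) :
    IsSaddlePoint f z ↔ gradX f z.1 z.2 = 0 ∧ gradY f z.1 z.2 = 0 := by
  constructor
  · intro h
    constructor
    · have : IsLocalMin (fun x => f x z.2) z.1 := Filter.Eventually.of_forall fun x => (h x z.2).1
      rw [gradX, gradient, this.fderiv_eq_zero, map_zero]
    · have : IsLocalMax (fun y => f z.1 y) z.2 := Filter.Eventually.of_forall fun y => (h z.1 y).2
      rw [gradY, gradient, this.fderiv_eq_zero, map_zero]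
  · rintro ⟨h1, h2⟩ x y
    have h3 := hf.saddleClass.cvx z.1 x z.2
    have h4 := hf.saddleClass.ccv z.1 z.2 y
    rw [h1, inner_zero_left] at h3
    rw [h2, inner_zero_left] at h4
    have h5 : 0 ≤ p.mx / 2 * ‖x - z.1‖ ^ 2 := by positivity
    have h6 : 0 ≤ p.my / 2 * ‖y - z.2‖ ^ 2 := by positivity
    exact ⟨by linarith, by linarith⟩

theorem MemF.existsUnique_saddlePoint (hf : MemF p f) (hm : 0 < m) (hx : 0 < p.mx)
    (hy : 0 < p.my) : ∃! zs : Pt n m, IsSaddlePoint f zs := by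
  obtain ⟨z, hz⟩ := hf.saddleClass.exists_zero hx hy (hf.Lxy_nonneg hm)
  refine ⟨z, (hf.isSaddlePoint_iff hx.le hy.le z).2 hz, fun w hw => ?_⟩
  exact hf.saddleClass.zero_unique hx hy ((hf.isSaddlePoint_iff hx.le hy.le w).1 hw) hz

/-! ### The normalization -/

/-- The constants of a nonempty class `𝓕`. -/
structure Params.Consistent (p : Params) : Prop where
  mx_pos : 0 < p.mx
  my_pos : 0 < p.my
  mx_le : p.mx ≤ p.Lx
  my_le : p.my ≤ p.Ly
  Lxy_nonneg : 0 ≤ p.Lxy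

namespace Params.Consistent

variable (hp : p.Consistent)

include hp

theorem Lx_pos : 0 < p.Lx := hp.mx_pos.trans_le hp.mx_le

theorem Ly_pos : 0 < p.Ly := hp.my_pos.trans_le hp.my_le

omit hp in
theorem Lx_le : p.Lx ≤ p.L := le_max_left _ _

omit hp in
theorem Ly_le : p.Ly ≤ p.L := (le_max_right _ _).trans (le_max_right _ _)

theorem valid : p.Valid :=
  ⟨hp.mx_pos, hp.my_pos, hp.mx_le.trans Lx_le, hp.my_le.trans Ly_le, hp.Lxy_nonneg⟩

theorem ax_pos : 0 < p.ax := by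
  have := hp.Lx_pos; have := hp.Ly_pos
  unfold Params.ax; positivity

theorem ay_pos : 0 < p.ay := by
  have := hp.Lx_pos; have := hp.Ly_pos
  unfold Params.ay; positivity

theorem ax_mul_ay : p.ax * p.ay = 1 := by
  have := hp.Lx_pos; have := hp.Ly_pos
  rw [Params.ax, Params.ay, ← Real.mul_rpow (by positivity) (by positivity)]
  rw [div_mul_div_cancel₀ (by positivity), div_self (by positivity), Real.one_rpow]

theorem ax_pow_four : p.ax ^ 4 = p.Ly / p.Lx := by
  have := hp.Lx_pos; have := hp.Ly_pos
  rw [Params.ax, ← Real.rpow_natCast, ← Real.rpow_mul (by positivity)]; norm_num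

theorem ay_pow_four : p.ay ^ 4 = p.Lx / p.Ly := by
  have := hp.Lx_pos; have := hp.Ly_pos
  rw [Params.ay, ← Real.rpow_natCast, ← Real.rpow_mul (by positivity)]; norm_num

theorem rescale_Ly_eq : p.ay ^ 2 * p.Ly = p.ax ^ 2 * p.Lx := by
  have h1 := hp.ax_pow_four
  have h2 := hp.ax_mul_ay
  have h3 := hp.Lx_pos
  rw [eq_div_iff h3.ne'] at h1
  rw [← h1]
  calc p.ay ^ 2 * (p.ax ^ 4 * p.Lx) = (p.ax * p.ay) ^ 2 * (p.ax ^ 2 * p.Lx) := by ring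
    _ = _ := by rw [h2]; ring

theorem rescale_Lxy : p.rescale.Lxy = p.Lxy := by
  simp only [Params.rescale, hp.ax_mul_ay, one_mul]

theorem rescale_mx_mul_my : p.rescale.mx * p.rescale.my = p.mx * p.my := by
  simp only [Params.rescale]
  calc p.ax ^ 2 * p.mx * (p.ay ^ 2 * p.my) = (p.ax * p.ay) ^ 2 * (p.mx * p.my) := by ring
    _ = _ := by rw [hp.ax_mul_ay]; ring

theorem rescale_L : p.rescale.L = max (p.ax ^ 2 * p.Lx) p.Lxy := by
  have h := hp.rescale_Lxy
  simp only [Params.rescale] at h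
  simp only [Params.L, Params.rescale, h, hp.rescale_Ly_eq]
  rw [max_comm p.Lxy, ← max_assoc, max_self]

theorem ax_sq_mul_Lx_le : p.ax ^ 2 * p.Lx ≤ p.L := by
  have h3 := hp.Lx_pos
  have h4 := hp.Ly_pos
  have h5 : p.Lx ≤ p.L := Lx_le
  have h6 : p.Ly ≤ p.L := Ly_le
  refine abs_le_of_sq_le_sq' ?_ (by linarith) |>.2
  calc (p.ax ^ 2 * p.Lx) ^ 2 = p.ax ^ 4 * p.Lx * p.Lx := by ring
    _ = p.Ly * p.Lx := by rw [hp.ax_pow_four]; field_simp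
    _ ≤ p.L * p.L := mul_le_mul h6 h5 h3.le (h4.le.trans h6)
    _ = _ := by ring

theorem rescale_L_le : p.rescale.L ≤ p.L := by
  rw [hp.rescale_L]
  exact max_le hp.ax_sq_mul_Lx_le Params.Valid.Lxy_le

theorem rescale_consistent : p.rescale.Consistent where
  mx_pos := mul_pos (pow_pos hp.ax_pos 2) hp.mx_pos
  my_pos := mul_pos (pow_pos hp.ay_pos 2) hp.my_pos
  mx_le := mul_le_mul_of_nonneg_left hp.mx_le (sq_nonneg _)
  my_le := mul_le_mul_of_nonneg_left hp.my_le (sq_nonneg _)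
  Lxy_nonneg := by rw [hp.rescale_Lxy]; exact hp.Lxy_nonneg

theorem rescale_cond_le : p.rescale.cond ≤ p.cond := by
  rw [Params.cond, Params.cond, hp.rescale_mx_mul_my]
  have := hp.mx_pos
  have := hp.my_pos
  have := hp.rescale_consistent.valid.L_pos
  gcongr
  exact hp.rescale_L_le

theorem rescale_logCond_le : p.rescale.logCond ≤ p.logCond :=
  max_le_max le_rfl (Real.log_le_log hp.rescale_consistent.valid.cond_pos hp.rescale_cond_le)

theorem rescale_complexity_le : p.rescale.complexity ≤
    3 * (p.Lx / p.mx + p.L * p.Lxy / (p.mx * p.my) + p.Ly / p.my) := by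
  have hx := hp.mx_pos
  have hy := hp.my_pos
  have hx' := hp.rescale_consistent.mx_pos
  have hy' := hp.rescale_consistent.my_pos
  have hLx := hp.Lx_pos
  have hLy := hp.Ly_pos
  have hL := hp.valid.L_pos
  have hxy := hp.Lxy_nonneg
  have hL' := hp.rescale_L
  have hax := hp.ax_pos
  have hay := hp.ay_pos
  have hprod := hp.rescale_mx_mul_my
  have hsum : p.rescale.L ≤ p.ax ^ 2 * p.Lx + p.Lxy := by
    rw [hL']; exact max_le (by linarith) (by linarith [mul_pos (pow_pos hax 2) hLx])
  have hmxL : p.rescale.mx ≤ p.L :=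
    (hp.rescale_consistent.valid.mx_le).trans hp.rescale_L_le
  have hmyL : p.rescale.my ≤ p.L :=
    (hp.rescale_consistent.valid.my_le).trans hp.rescale_L_le
  -- The ratio `Lx/mx` and the product `mx my` are invariant under the rescaling, and the new `L` is
  -- at most the common smoothness constant plus `Lxy`. The first summand keeps the ratio; the
  -- second is expanded by the rescaled `my ≤ L`.
  have h1 : p.rescale.L / p.rescale.mx ≤ p.Lx / p.mx + p.L * p.Lxy / (p.mx * p.my) := by
    calc p.rescale.L / p.rescale.mx ≤ (p.ax ^ 2 * p.Lx + p.Lxy) / p.rescale.mx := by gcongr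
      _ = (p.ax ^ 2 * p.Lx) / (p.ax ^ 2 * p.mx)
          + p.rescale.my * p.Lxy / (p.rescale.mx * p.rescale.my) := by
        rw [add_div, mul_comm p.rescale.my, mul_div_mul_right _ _ hy'.ne']; rfl
      _ ≤ _ := by
        rw [hprod, mul_div_mul_left _ _ (by positivity)]
        gcongr
  have h2 : p.rescale.L / p.rescale.my ≤ p.Ly / p.my + p.L * p.Lxy / (p.mx * p.my) := by
    rw [← hp.rescale_Ly_eq] at hsum
    calc p.rescale.L / p.rescale.my ≤ (p.ay ^ 2 * p.Ly + p.Lxy) / p.rescale.my := by gcongr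
      _ = (p.ay ^ 2 * p.Ly) / (p.ay ^ 2 * p.my)
          + p.rescale.mx * p.Lxy / (p.rescale.mx * p.rescale.my) := by
        rw [add_div, mul_div_mul_left p.Lxy _ hx'.ne']; rfl
      _ ≤ _ := by
        rw [hprod, mul_div_mul_left _ _ (by positivity)]
        gcongr
  have h3 : p.rescale.L * p.rescale.Lxy / (p.rescale.mx * p.rescale.my)
      ≤ p.L * p.Lxy / (p.mx * p.my) := by
    rw [hprod, hp.rescale_Lxy]
    gcongr
    exact hp.rescale_L_le
  have h4 : 0 < p.Lx / p.mx := by positivity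
  have h5 : 0 < p.Ly / p.my := by positivity
  unfold Params.complexity
  linarith

theorem ax_pow_four_le : p.ax ^ 4 ≤ p.cond := by
  rw [hp.ax_pow_four]
  refine le_trans ?_ hp.valid.Lmx_le_cond
  have := hp.Lx_pos
  have := hp.mx_pos
  have := hp.valid.L_pos
  exact div_le_div₀ this.le Ly_le hp.mx_pos hp.mx_le

theorem ay_pow_four_le : p.ay ^ 4 ≤ p.cond := by
  rw [hp.ay_pow_four]
  refine le_trans ?_ hp.valid.Lmy_le_cond
  exact div_le_div₀ hp.valid.L_pos.le Lx_le hp.my_pos hp.my_le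

end Params.Consistent

theorem MemF.consistent (hf : MemF p f) (hn : 0 < n) (hm : 0 < m) (hx : 0 < p.mx)
    (hy : 0 < p.my) : p.Consistent :=
  ⟨hx, hy, hf.mx_le_Lx hn, hf.my_le_Ly hm, hf.Lxy_nonneg hm⟩

theorem enorm2_smul_sq_le {a b c : ℝ} (ha : a ^ 2 ≤ c) (hb : b ^ 2 ≤ c) (z : Pt n m) :
    enorm2 (a • z.1, b • z.2) ^ 2 ≤ c * enorm2 z ^ 2 := by
  rw [enorm2_sq, enorm2_sq]
  simp only [norm_smul, mul_pow, Real.norm_eq_abs, sq_abs]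
  rw [mul_add]
  gcongr

/-- Proximal Best Response on `f`, before the choice of the number of iterations. -/
theorem proximalBestResponse_exists (hf : MemF p f) (hp : p.Consistent) {zs : Pt n m}
    (hzs : IsSaddlePoint f zs) (z₀ : Pt n m) {A : ℝ} (hA : 1 ≤ A) :
    ∃ T r, ProximalBestResponse p f z₀ T r ∧
      enorm2 (r.val - zs) ^ 2 ≤ 26 * p.cond ^ 4 * ((Real.exp A)⁻¹ * enorm2 (z₀ - zs) ^ 2) ∧
      (r.calls : ℝ) ≤ 440000 * √(p.Lx / p.mx + p.L * p.Lxy / (p.mx * p.my) + p.Ly / p.my) *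
        p.logCond ^ 3 * A := by
  have hax := hp.ax_pos
  have hay := hp.ay_pos
  have hc := hp.valid.cond_pos
  obtain ⟨hzx, hzy⟩ := (hf.isSaddlePoint_iff hp.mx_pos.le hp.my_pos.le zs).1 hzs
  have hp' := hp.rescale_consistent
  have hcl := (hf.saddleClass.rescale hax.le hay.le).mono (mx' := p.rescale.mx)
    (my' := p.rescale.my) (Lx' := p.rescale.L) (Lxy' := p.rescale.Lxy) (Ly' := p.rescale.L)
    le_rfl le_rfl (Params.Consistent.Lx_le (p := p.rescale)) le_rfl
    (Params.Consistent.Ly_le (p := p.rescale))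
  obtain ⟨T, s, hs, hsd, hsc⟩ := pbrRun_complexity
    (O := rescaleOracle p (gradOracle f)) hp'.valid hcl
    (fun z => by simp [rescaleOracle, gradOracle]) (fun z => by simp [rescaleOracle, gradOracle])
    (zs := (p.ax⁻¹ • zs.1, p.ay⁻¹ • zs.2))
    (by simp only [smul_inv_smul₀ hax.ne', smul_inv_smul₀ hay.ne', hzx, smul_zero])
    (by simp only [smul_inv_smul₀ hax.ne', smul_inv_smul₀ hay.ne', hzy, smul_zero])
    (p.ax⁻¹ • z₀.1, p.ay⁻¹ • z₀.2) hA
  refine ⟨T, _, ⟨s, hs, rfl⟩, ?_, ?_⟩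
  · have hay' : p.ax⁻¹ = p.ay := inv_eq_of_mul_eq_one_right hp.ax_mul_ay
    have hax' : p.ay⁻¹ = p.ax := inv_eq_of_mul_eq_one_left hp.ax_mul_ay
    have e1 : (p.ax • s.val.1.1, p.ay • s.val.1.2) - zs
        = (p.ax • (s.val.1 - (p.ax⁻¹ • zs.1, p.ay⁻¹ • zs.2)).1,
          p.ay • (s.val.1 - (p.ax⁻¹ • zs.1, p.ay⁻¹ • zs.2)).2) := by
      simp only [Prod.fst_sub, Prod.snd_sub, smul_sub, smul_inv_smul₀ hax.ne',
        smul_inv_smul₀ hay.ne']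
      rfl
    have e2 : ((p.ax⁻¹ • z₀.1, p.ay⁻¹ • z₀.2) : Pt n m) - (p.ax⁻¹ • zs.1, p.ay⁻¹ • zs.2)
        = (p.ay • (z₀ - zs).1, p.ax • (z₀ - zs).2) := by
      rw [hax', hay', Prod.fst_sub, Prod.snd_sub, smul_sub, smul_sub]
      rfl
    -- Scaling in and scaling back each distort squared distances by at most `√cond`, which raises
    -- the power of `cond` from three to four.
    have hx2 : p.ax ^ 2 ≤ √p.cond := Real.le_sqrt_of_sq_le (by
      rw [← pow_mul]; exact hp.ax_pow_four_le)
    have hy2 : p.ay ^ 2 ≤ √p.cond := Real.le_sqrt_of_sq_le (by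
      rw [← pow_mul]; exact hp.ay_pow_four_le)
    rw [e2] at hsd
    have hd0 := enorm2_smul_sq_le hy2 hx2 (z₀ - zs)
    have hc' := hp'.valid.cond_pos
    simp only
    rw [e1]
    refine (enorm2_smul_sq_le hx2 hy2 _).trans ?_
    calc √p.cond * enorm2 (s.val.1 - (p.ax⁻¹ • zs.1, p.ay⁻¹ • zs.2)) ^ 2
        ≤ √p.cond * (26 * p.cond ^ 3 * ((Real.exp A)⁻¹ * (√p.cond * enorm2 (z₀ - zs) ^ 2))) := by
          refine mul_le_mul_of_nonneg_left (hsd.trans ?_) (Real.sqrt_nonneg _)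
          gcongr
          exact hp.rescale_cond_le
      _ = √p.cond ^ 2 * (26 * p.cond ^ 3 * ((Real.exp A)⁻¹ * enorm2 (z₀ - zs) ^ 2)) := by ring
      _ = _ := by rw [Real.sq_sqrt hc.le]; ring
  · refine hsc.trans ?_
    have h1 : √p.rescale.complexity
        ≤ 2 * √(p.Lx / p.mx + p.L * p.Lxy / (p.mx * p.my) + p.Ly / p.my) := by
      have hx := hp.mx_pos
      have hy := hp.my_pos
      have hLx := hp.Lx_pos
      have hLy := hp.Ly_pos
      have hL := hp.valid.L_pos
      have hxy := hp.Lxy_nonneg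
      have h0 : 0 ≤ p.Lx / p.mx + p.L * p.Lxy / (p.mx * p.my) + p.Ly / p.my := by positivity
      rw [Real.sqrt_le_left (by positivity), mul_pow, Real.sq_sqrt h0]
      linarith [hp.rescale_complexity_le]
    have hΛ := Params.Valid.one_le_logCond (p := p.rescale)
    calc 220000 * √p.rescale.complexity * p.rescale.logCond ^ 3 * A
        ≤ 220000 * (2 * √(p.Lx / p.mx + p.L * p.Lxy / (p.mx * p.my) + p.Ly / p.my))
          * p.logCond ^ 3 * A := by
          gcongr
          exact hp.rescale_logCond_le
      _ = _ := by ring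

end Minimax

/-! ### The choice of the number of iterations. -/

theorem theorem3 :
    ∃ C : ℝ, 0 < C ∧
      ∀ (n m : ℕ), 0 < n → 0 < m →
      ∀ (mx my Lx Lxy Ly L : ℝ), 0 < mx → 0 < my → L = max Lx (max Lxy Ly) →
      ∀ f : Minimax.Vec n → Minimax.Vec m → ℝ, Minimax.MemF ⟨mx, my, Lx, Lxy, Ly⟩ f →
        (∃! zs : Minimax.Pt n m, Minimax.IsSaddlePoint f zs) ∧
        ∀ zs : Minimax.Pt n m, Minimax.IsSaddlePoint f zs →
        ∀ (z₀ : Minimax.Pt n m) (ε : ℝ), 0 < ε →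
          ∃ (T : ℕ) (r : Minimax.Counted (Minimax.Pt n m)),
            Minimax.ProximalBestResponse ⟨mx, my, Lx, Lxy, Ly⟩ f z₀ T r ∧
            Minimax.enorm2 (r.val - zs) ≤ ε ∧
            (r.calls : ℝ) ≤
              C * √(Lx / mx + L * Lxy / (mx * my) + Ly / my) *
                max 1 (Real.log (L ^ 2 / (mx * my))) ^ 3 *
                max 1 (Real.log (L ^ 2 / (mx * my) * (Minimax.enorm2 (z₀ - zs) / ε))) := by
  refine ⟨3520000, by norm_num, ?_⟩
  intro n m hn hm mx my Lx Lxy Ly L hx hy hL f hf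
  subst hL
  have hp := hf.consistent hn hm hx hy
  refine ⟨hf.existsUnique_saddlePoint hm hx hy, fun zs hzs z₀ ε hε => ?_⟩
  set B := max 1 (Real.log (max Lx (max Lxy Ly) ^ 2 / (mx * my) *
    (Minimax.enorm2 (z₀ - zs) / ε))) with hB
  have hB1 : 1 ≤ B := le_max_left _ _
  -- If the start is already accurate, no iteration is made. Otherwise the ratio `t` of distance to
  -- `ε` is at least `1`, so `t² ≤ t⁴` below.
  by_cases hd : Minimax.enorm2 (z₀ - zs) ≤ ε
  · have hax := hp.ax_pos
    have hay := hp.ay_pos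
    refine ⟨0, ⟨z₀, 0⟩, ⟨_, .init, ?_⟩, hd, ?_⟩
    · simp only [smul_inv_smul₀ hax.ne', smul_inv_smul₀ hay.ne']
    · simp only [Nat.cast_zero]
      positivity
  · rw [not_le] at hd
    -- Of `e^(8B)`, one factor `e^(4B)` absorbs `26 ≤ 2.7⁴`, because `B ≥ 1`; the other absorbs `(κ
    -- t)⁴`. Hence also the constant `8 · 440000`.
    obtain ⟨T, r, hr, hrd, hrc⟩ := Minimax.proximalBestResponse_exists hf hp hzs z₀
      (A := 8 * B) (by linarith)
    refine ⟨T, r, hr, ?_, ?_⟩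
    · refine abs_le_of_sq_le_sq' (hrd.trans ?_) hε.le |>.2
      have hκ := hp.valid.one_le_cond
      have hκB : Real.log (Minimax.Params.cond ⟨mx, my, Lx, Lxy, Ly⟩ *
          (Minimax.enorm2 (z₀ - zs) / ε)) ≤ B := le_max_right _ _
      generalize Minimax.Params.cond ⟨mx, my, Lx, Lxy, Ly⟩ = κ at hκ hκB ⊢
      generalize Minimax.enorm2 (z₀ - zs) = d at hd hκB ⊢
      have ht : 1 ≤ d / ε := by rw [one_le_div hε]; exact hd.le
      have he : d = d / ε * ε := by field_simp
      generalize d / ε = t at ht hκB he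
      subst he
      have h1 : κ * t ≤ Real.exp B := by
        rw [← Real.log_le_iff_le_exp (by positivity)]; exact hκB
      have h2 : (2.7 : ℝ) ≤ Real.exp B := by
        have h3 := Real.exp_one_gt_d9
        have h4 := Real.exp_le_exp.2 hB1
        linarith
      have h3 : 26 * κ ^ 4 * t ^ 2 ≤ Real.exp (8 * B) := by
        have e : Real.exp (8 * B) = Real.exp B ^ 4 * Real.exp B ^ 4 := by
          rw [← pow_add, ← Real.exp_nat_mul]; norm_num
        rw [e]
        calc 26 * κ ^ 4 * t ^ 2 ≤ 2.7 ^ 4 * (κ ^ 4 * t ^ 4) := by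
              have h5 : t ^ 2 ≤ t ^ 4 := pow_le_pow_right₀ ht (by norm_num)
              have h6 : κ ^ 4 * t ^ 2 ≤ κ ^ 4 * t ^ 4 := by gcongr
              have h7 : 0 < κ ^ 4 * t ^ 4 := by positivity
              norm_num
              linarith
          _ = 2.7 ^ 4 * (κ * t) ^ 4 := by ring
          _ ≤ _ := by gcongr
      have hE := Real.exp_pos (8 * B)
      calc 26 * κ ^ 4 * ((Real.exp (8 * B))⁻¹ * (t * ε) ^ 2)
          = 26 * κ ^ 4 * t ^ 2 / Real.exp (8 * B) * ε ^ 2 := by field_simp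
        _ ≤ 1 * ε ^ 2 := by
          gcongr
          rwa [div_le_one hE]
        _ = _ := one_mul _
    · refine hrc.trans (le_of_eq ?_)
      simp only [Minimax.Params.logCond, Minimax.Params.cond, Minimax.Params.L]
      ring
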